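/- Let $SG\subset\mathbb R^2$ be the Sierpinski gasket, i.e. the nonempty compact set with $SG=\bigcup_{i=0}^2F_i(SG)$, where $F_i(x)=\tfrac12(x+q_i)$ and $q_0,q_1,q_2$ are the vertices of an equilateral triangle. For a word $w=w_1\cdots w_m$ put $F_w=F_{w_1}\circ\cdots\circ F_{w_m}$, $V_0=\{q_0,q_1,q_2\}$ and $V_m=\bigcup_{|w|=m}F_wV_0$; write $x\underset{m}{\sim}y$ if $x\neq y$ and $x,y\in F_wV_0$ for some $w$ with $|w|=m$. Let $\mu$ be the standard self-similar probability measure on $SG$ and $r=\tfrac35$. Let $\mathcal E(u,v)=\lim_{m\to\infty}r^{-m}\sum_{x\underset{m}{\sim}y}(u(x)-u(y))(v(x)-v(y))$ (each edge counted once) be the standard energy, and let $\operatorname{dom}\mathcal E$ be the set of continuous real functions $u$ on $SG$ with $\mathcal E(u,u)<\infty$. For $u\in\operatorname{dom}\mathcal E$ write $\Delta u=f$ if $\mathcal E(u,v)=-\int fv\,d\mu$ for all $v\in\operatorname{dom}\mathcal E$ with $v|_{V_0}=0$. We say $u\in\operatorname{dom}\Delta$ if this holds with $f$ continuous, and $u\in\operatorname{dom}_{L^2}\Delta$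 if it holds with $f\in L^2(\mu)$; for $u\in\operatorname{dom}\Delta$ we let $\Delta u$ denote the continuous function. Put $T(u)=\int_{SG}(\Delta u)^2\,d\mu$ for $u\in\operatorname{dom}_{L^2}\Delta$, and let $\Delta_mu(z)=\sum_{y\underset{m}{\sim}z}(u(y)-u(z))$ be the graph Laplacian. **Lemma.** Let $m\ge0$, let $E\subseteq V_m$ (for instance $E=V_m$), and let real values $a(x)$, $x\in E$, be given. Suppose $u$ minimizes $T$ over all $v\in\operatorname{dom}_{L^2}\Delta$ with $v|_E=a$. Then: 1. $u\in\operatorname{dom}\Delta$ and $\Delta u|_{V_0}=0$; 2. for every $z\in V_m\setminus V_0$, $$\Delta_mu(z)=\frac1{45\cdot5^m}\Big(14\,\Delta u(z)+4\sum_{y\underset{m}{\sim}z}\Delta u(y)\Big);$$ 3. $$T(u)=\int_{SG}|\Delta u|^2\,d\mu=r^{-m}\sum_{z\in V_m\setminus V_0}\Delta u(z)\,\Delta_mu(z).$$ -/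

import Mathlib

open Filter MeasureTheory Topology

noncomputable section

namespace Gasket

/-- The plane. -/
abbrev Plane : Type := EuclideanSpace ℝ (Fin 2)

/-- The vertices `q₀, q₁, q₂` of an equilateral triangle in the plane. -/
def corner : Fin 3 → Plane :=
  ![!₂[1 / 2, √3 / 2], !₂[0, 0], !₂[1, 0]]

/-- The contraction `F_i x = (x + q_i) / 2` of the plane. -/
def contraction (i : Fin 3) (x : Plane) : Plane := (1 / 2 : ℝ) • (x + corner i)

/-- The point `lim F_{ω₀} ∘ ⋯ ∘ F_{ωₙ} (x) = ∑ 2^{-(k+1)} q_{ω_k}` with address `ω`. -/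
def codingPlane (ω : ℕ → Fin 3) : Plane := ∑' k, ((1 / 2 : ℝ) ^ (k + 1)) • corner (ω k)

/-- The Sierpinski gasket. By `nonempty_SG`, `isCompact_SG` and `SG_eq_iUnion` below it is the
nonempty compact subset of the plane that satisfies `SG = F₀ SG ∪ F₁ SG ∪ F₂ SG`. -/
def SG : Set Plane := Set.range codingPlane

theorem norm_corner_le (i : Fin 3) : ‖corner i‖ ≤ 1 := by
  fin_cases i <;> simp [corner, EuclideanSpace.norm_eq, Fin.sum_univ_two, div_pow]
  norm_num

theorem norm_term_le (k : ℕ) (i : Fin 3) :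
    ‖((1 / 2 : ℝ) ^ (k + 1)) • corner i‖ ≤ (1 / 2 : ℝ) ^ (k + 1) := by
  rw [norm_smul, norm_pow, Real.norm_of_nonneg (by norm_num : (0 : ℝ) ≤ 1 / 2)]
  exact mul_le_of_le_one_right (by positivity) (norm_corner_le i)

theorem summable_half : Summable fun k : ℕ => (1 / 2 : ℝ) ^ (k + 1) :=
  (summable_nat_add_iff 1).2 summable_geometric_two

theorem summable_coding (ω : ℕ → Fin 3) :
    Summable fun k => ((1 / 2 : ℝ) ^ (k + 1)) • corner (ω k) :=
  Summable.of_norm_bounded summable_half fun k => norm_term_le k (ω k)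

theorem continuous_codingPlane : Continuous codingPlane := by
  refine continuous_tsum (fun k => ?_) summable_half (fun k ω => norm_term_le k (ω k))
  have h : Continuous corner := continuous_of_discreteTopology
  fun_prop

theorem codingPlane_eq (ω : ℕ → Fin 3) :
    codingPlane ω = contraction (ω 0) (codingPlane fun k => ω (k + 1)) := by
  unfold codingPlane contraction
  rw [(summable_coding ω).tsum_eq_zero_add, smul_add,
    ← (summable_coding fun k => ω (k + 1)).tsum_const_smul (1 / 2 : ℝ), add_comm]
  simp only [smul_smul, ← pow_succ', zero_add, pow_one]

theorem contraction_mem_SG (i : Fin 3) {x : Plane} (hx : x ∈ SG) : contraction i x ∈ SG := by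
  obtain ⟨ω, rfl⟩ := hx
  let ω' : ℕ → Fin 3 := fun n => Nat.casesOn n i ω
  have h : codingPlane ω' = contraction i (codingPlane ω) := codingPlane_eq ω'
  exact ⟨ω', h⟩

theorem corner_mem_SG (i : Fin 3) : corner i ∈ SG := by
  refine ⟨fun _ => i, ?_⟩
  have h : ∑' k : ℕ, (1 / 2 : ℝ) ^ (k + 1) = 1 := by
    simp only [pow_succ, tsum_mul_right, tsum_geometric_two]
    norm_num
  rw [codingPlane, summable_half.tsum_smul_const, h, one_smul]

theorem nonempty_SG : SG.Nonempty := ⟨_, corner_mem_SG 0⟩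

theorem isCompact_SG : IsCompact SG := isCompact_range continuous_codingPlane

theorem SG_eq_iUnion : SG = ⋃ i, contraction i '' SG := by
  ext x
  simp only [Set.mem_iUnion]
  constructor
  · rintro ⟨ω, rfl⟩
    exact ⟨ω 0, _, ⟨_, rfl⟩, (codingPlane_eq ω).symm⟩
  · rintro ⟨i, y, hy, rfl⟩
    exact contraction_mem_SG i hy

/-- The boundary point `q_i` as a point of the gasket. -/
def q (i : Fin 3) : SG := ⟨corner i, corner_mem_SG i⟩

/-- The map `F_i : SG → SG`. -/
def F (i : Fin 3) (x : SG) : SG := ⟨contraction i x, contraction_mem_SG i x.2⟩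

/-- The map `F_w = F_{w₀} ∘ ⋯ ∘ F_{w_{m-1}}` for a word `w` of length `m`. -/
def cellMap : (m : ℕ) → (Fin m → Fin 3) → SG → SG
  | 0, _ => id
  | m + 1, w => F (w 0) ∘ cellMap m (fun k => w k.succ)

/-- The address map onto the gasket. -/
def coding (ω : ℕ → Fin 3) : SG := ⟨codingPlane ω, ω, rfl⟩

/-- The standard self-similar probability measure `μ` on the gasket: the law of the point whose
address is a sequence of independent uniform digits. -/
def stdMeasure : Measure SG :=
  (Measure.infinitePi fun _ : ℕ => (PMF.uniformOfFintype (Fin 3)).toMeasure).map coding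

open Classical in
/-- The vertices `V_m = ⋃_{|w| = m} F_w {q₀, q₁, q₂}`. -/
def V (m : ℕ) : Finset SG :=
  Finset.univ.image fun p : (Fin m → Fin 3) × Fin 3 => cellMap m p.1 (q p.2)

open Classical in
/-- The vertices `V_m \ V_0`. -/
def innerV (m : ℕ) : Finset SG := V m \ V 0

/-- The graph of level `m`: two distinct points are adjacent if they are corners of a common
cell of level `m`. -/
def levelGraph (m : ℕ) : SimpleGraph SG where
  Adj x y := x ≠ y ∧ ∃ (w : Fin m → Fin 3) (i j : Fin 3), x = cellMap m w (q i) ∧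
    y = cellMap m w (q j)
  symm := ⟨fun _ _ ⟨h, w, i, j, hx, hy⟩ => ⟨h.symm, w, j, i, hy, hx⟩⟩
  loopless := ⟨fun _ h => h.1 rfl⟩

open Classical in
/-- The neighbours of `z` in the graph of level `m`. -/
def neighbors (m : ℕ) (z : SG) : Finset SG := {y ∈ V m | (levelGraph m).Adj z y}

/-- The discrete Laplacian `Δ_m u (z) = ∑_{y ∼ z} (u y - u z)`. -/
def graphLaplacian (m : ℕ) (u : SG → ℝ) (z : SG) : ℝ := ∑ y ∈ neighbors m z, (u y - u z)

/-- The renormalised graph energy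
`E_m(u, v) = (5/3)^m ∑_{|w| = m} ∑_{edges} (u x - u y) (v x - v y)`. The three edges of the cell
of `w` are `F_w q_i`, `F_w q_{i+1}` with `i` modulo 3. -/
def graphEnergy (m : ℕ) (u v : SG → ℝ) : ℝ :=
  (5 / 3 : ℝ) ^ m * ∑ w : Fin m → Fin 3, ∑ i : Fin 3,
    (u (cellMap m w (q i)) - u (cellMap m w (q (i + 1)))) *
      (v (cellMap m w (q i)) - v (cellMap m w (q (i + 1))))

/-- `u ∈ dom E`: `u` is continuous and `E(u, u) = lim E_m(u, u)`, the limit of a nondecreasing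
sequence, is finite. -/
def MemDomE (u : SG → ℝ) : Prop :=
  Continuous u ∧ BddAbove (Set.range fun m => graphEnergy m u u)

/-- `Δ_μ u = f` in the weak sense: `u ∈ dom E`, and `E(u, v) = lim E_m(u, v)` equals
`-∫ f v dμ` for all `v ∈ dom E` that vanish on `V_0`. -/
def IsLaplacian (u f : SG → ℝ) : Prop :=
  MemDomE u ∧ ∀ v : SG → ℝ, MemDomE v → (∀ i, v (q i) = 0) →
    Tendsto (fun m => graphEnergy m u v) atTop (𝓝 (-∫ x, f x * v x ∂stdMeasure))

/-- `u ∈ dom Δ`: the Laplacian of `u` is a continuous function. -/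
def MemDomLaplacian (u : SG → ℝ) : Prop := ∃ f, Continuous f ∧ IsLaplacian u f

/-- `u ∈ dom_{L²} Δ`: the Laplacian of `u` is in `L²(μ)`. -/
def MemDomL2Laplacian (u : SG → ℝ) : Prop := ∃ f, MemLp f 2 stdMeasure ∧ IsLaplacian u f

open Classical in
/-- `Δ u`: the continuous function if `u ∈ dom Δ`, otherwise a representative of the class in
`L²(μ)` if `u ∈ dom_{L²} Δ` (and `0` if `u ∉ dom_{L²} Δ`). -/
def laplacian (u : SG → ℝ) : SG → ℝ :=
  if h : MemDomLaplacian u then h.choose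
  else if h : MemDomL2Laplacian u then h.choose
  else 0

/-- `T(u) = ∫ (Δ u)² dμ`. -/
def T (u : SG → ℝ) : ℝ := ∫ x, laplacian u x ^ 2 ∂stdMeasure

/-- `u` minimizes `T` over the functions in `dom_{L²} Δ` with prescribed values `a` on `E`. -/
def IsMinimizer (E : Set SG) (a u : SG → ℝ) : Prop :=
  MemDomL2Laplacian u ∧ (∀ x ∈ E, u x = a x) ∧
    ∀ v : SG → ℝ, MemDomL2Laplacian v → (∀ x ∈ E, v x = a x) → T u ≤ T v

end Gasket

end

/-!
Write `f = Δu` for the minimizer `u`. If `Δw = g` and `w` vanishes on `E`, then `u + t w` competes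
with `u`, so `f` is orthogonal to `g` in `L²(μ)` (`IsMinimizer.integral_mul_eq_zero`). This holds
for every `g` orthogonal to the splines of level `m`, the continuous functions that are harmonic in
each cell of level `m`, that vanish on `V_0`: the solution `W` of the Dirichlet problem `ΔW = g`
has level-`m` energy `-∫ g ψ = 0` against every such spline `ψ`, so `W` vanishes on
`V_m ⊇ E`. Hence `f` is itself a spline of level `m` that vanishes on `V_0`
(`IsMinimizer.exists_isLaplacian_spline`), which is the first claim.

The energy of `u` against a spline `ψ` of level `m` is the graph energy of level `m`. Summation by
parts (`graphEnergy_eq_sum_graphLaplacian`) turns the weak equation into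
`r^{-m} ∑_z ψ(z) Δ_m u(z) = ∫ f ψ dμ`. With `ψ = f` this is the formula for `T u`. With `ψ` the
tent function at `z` it is the formula for `Δ_m u(z)`: the basic harmonic functions have
`∫ h_i² = 7/45` and `∫ h_i h_j = 4/45`, which self-similarity determines
(`integral_harmBasis_mul`), cells have measure `3^{-m}`, and two cells meet at each inner
vertex (`card_cellsAt`).

Three facts have to be supplied. Harmonic functions exist as the fixed point of a contraction
(`contracting_simplexStep`). The Dirichlet problem is solved level by level: energies of splines do
not change under refinement (`graphEnergy_spline`), so the discrete solutions are compatible, and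
they converge uniformly by an energy estimate (`exists_isLaplacian_eq_zero`). The function `Δu` is
unique almost everywhere, since splines that vanish on `V_0` determine an integrable function and
`V_0` is a null set (`IsLaplacian.ae_eq`).
-/

noncomputable section

namespace Gasket

/-! ### Barycentric coordinates and the overlap of cells -/

/-- The barycentric coordinates of a point of the plane with respect to the three corners. -/
def bary (i : Fin 3) (x : Plane) : ℝ :=
  ![2 / √3 * x 1, 1 - x 0 - x 1 / √3, x 0 - x 1 / √3] i

theorem continuous_bary (i : Fin 3) : Continuous (bary i) := by
  unfold bary
  fin_cases i <;> simp <;> fun_prop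

theorem bary_sum (x : Plane) : bary 0 x + bary 1 x + bary 2 x = 1 := by
  simp only [bary]
  simp
  ring

theorem bary_contraction (i j : Fin 3) (x : Plane) :
    bary i (contraction j x) = (bary i x + if i = j then 1 else 0) / 2 := by
  have h3 : √3 ≠ 0 := by positivity
  have h4 : √3 * √3 = 3 := Real.mul_self_sqrt (by norm_num)
  fin_cases i <;> fin_cases j <;> simp [bary, contraction, corner] <;> field_simp <;> ring_nf

theorem bary_injective {x y : Plane} (h0 : bary 0 x = bary 0 y) (h2 : bary 2 x = bary 2 y) :
    x = y := by
  have h3 : √3 ≠ 0 := by positivity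
  simp only [bary] at h0 h2
  simp at h0 h2
  have h1 : x 1 = y 1 := h0
  rw [h1] at h2
  ext k
  fin_cases k
  · simpa using h2
  · exact h1

instance : CompactSpace SG := isCompact_iff_compactSpace.1 isCompact_SG

instance : Nonempty SG := ⟨q 0⟩

theorem exists_F_eq (x : SG) : ∃ i y, F i y = x := by
  obtain ⟨i, y, hy, h⟩ := Set.mem_iUnion.1 (SG_eq_iUnion.subset x.2)
  exact ⟨i, ⟨y, hy⟩, Subtype.ext h⟩

/-- A minimum of a coordinate over the compact gasket is attained at some `F_j y`, where the
coordinate is at least half its value at `y`; so the minimum is nonnegative. -/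
theorem bary_nonneg (i : Fin 3) (x : SG) : 0 ≤ bary i x := by
  obtain ⟨z, -, hz⟩ := isCompact_univ.exists_isMinOn ⟨q 0, Set.mem_univ _⟩
    (show Continuous fun x : SG => bary i x from
      (continuous_bary i).comp continuous_subtype_val).continuousOn
  obtain ⟨j, y, rfl⟩ := exists_F_eq z
  have h1 : bary i (F j y) ≤ bary i y := hz (Set.mem_univ y)
  have h2 : bary i (F j y) ≤ bary i x := hz (Set.mem_univ x)
  have h3 : bary i (F j y) = (bary i y + if i = j then 1 else 0) / 2 := bary_contraction i j y
  have h4 : (0 : ℝ) ≤ if i = j then 1 else 0 := by split_ifs <;> norm_num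
  linarith

theorem bary_q (j i : Fin 3) : bary j (q i : Plane) = if j = i then 1 else 0 := by
  have h3 : √3 ≠ 0 := by positivity
  fin_cases i <;> fin_cases j <;> simp [bary, q, corner] <;> field_simp <;> norm_num

theorem q_eq_of_bary_eq_one {i : Fin 3} {x : SG} (h : bary i x = 1) : x = q i := by
  have := bary_sum (x : Plane)
  have h0 := bary_nonneg 0 x
  have h1 := bary_nonneg 1 x
  have h2 := bary_nonneg 2 x
  apply Subtype.ext
  apply bary_injective <;> rw [bary_q] <;> fin_cases i <;> simp at h ⊢ <;> linarith

theorem F_q (i : Fin 3) : F i (q i) = q i := by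
  apply Subtype.ext
  change contraction i (corner i) = corner i
  rw [contraction, ← two_smul ℝ, smul_smul]
  norm_num

theorem F_q_comm (i j : Fin 3) : F i (q j) = F j (q i) := by
  apply Subtype.ext
  change contraction i (corner j) = contraction j (corner i)
  rw [contraction, contraction, add_comm]

theorem F_injective (i : Fin 3) : Function.Injective (F i) := by
  intro x y h
  have h' : contraction i x = contraction i y := congrArg Subtype.val h
  rw [contraction, contraction] at h'
  exact Subtype.ext
    (add_right_cancel (smul_right_injective Plane (by norm_num : (1 / 2 : ℝ) ≠ 0) h'))

/-- Distinct cells of level one meet only in their common corner. -/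
theorem eq_q_of_F_eq_F {i j : Fin 3} (hij : i ≠ j) {x y : SG} (h : F i x = F j y) :
    x = q j := by
  have h' : contraction i x = contraction j y := congrArg Subtype.val h
  apply q_eq_of_bary_eq_one
  have hi := bary_contraction i i x
  have hj := bary_contraction j i x
  have hi' := bary_contraction i j y
  have hj' := bary_contraction j j y
  have e1 := bary_nonneg i y
  have e2 := bary_nonneg j y
  have f1 := bary_nonneg 0 x
  have f2 := bary_nonneg 1 x
  have f3 := bary_nonneg 2 x
  have s := bary_sum (x : Plane)
  rw [h'] at hi hj
  simp [hij, hij.symm] at hi hj hi' hj'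
  have : bary i x + bary j x ≤ 1 := by
    fin_cases i <;> fin_cases j <;> simp at hij ⊢ <;> linarith
  have e3 := bary_nonneg i x
  linarith

theorem continuous_F (i : Fin 3) : Continuous (F i) := by
  unfold F contraction
  fun_prop

theorem dist_F (i : Fin 3) (x y : SG) : dist (F i x) (F i y) = dist x y / 2 := by
  change dist (contraction i x) (contraction i y) = dist (x : Plane) y / 2
  rw [contraction, contraction, dist_smul₀, dist_add_right]
  norm_num
  ring

theorem dist_le_two (x y : SG) : dist x y ≤ 2 := by
  have h : ∀ x : SG, ‖(x : Plane)‖ ≤ 1 := by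
    rintro ⟨_, ω, rfl⟩
    refine tsum_of_norm_bounded (a := 1) ?_ fun k => norm_term_le k (ω k)
    convert summable_half.hasSum using 1
    simp only [pow_succ, tsum_mul_right, tsum_geometric_two]
    norm_num
  calc dist x y = ‖(x : Plane) - y‖ := dist_eq_norm (x : Plane) y
    _ ≤ ‖(x : Plane)‖ + ‖(y : Plane)‖ := norm_sub_le _ _
    _ ≤ 2 := by linarith [h x, h y]

theorem cellMap_injective : ∀ (m : ℕ) (w : Fin m → Fin 3), Function.Injective (cellMap m w)
  | 0, _ => Function.injective_id
  | m + 1, w => (F_injective (w 0)).comp (cellMap_injective m _)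

theorem cellMap_cons (m : ℕ) (i : Fin 3) (w : Fin m → Fin 3) (x : SG) :
    cellMap (m + 1) (Fin.cons i w) x = F i (cellMap m w x) := by
  simp [cellMap]

theorem cellMap_consEquiv (n : ℕ) (i : Fin 3) (w : Fin n → Fin 3) (x : SG) :
    cellMap (n + 1) (Fin.consEquiv (fun _ => Fin 3) (i, w)) x = F i (cellMap n w x) :=
  cellMap_cons n i w x

theorem q_injective : Function.Injective q := by
  intro i j h
  by_contra hij
  have hb := bary_q i j
  rw [← h, bary_q] at hb
  simp [hij] at hb

/-- A corner of the gasket lies in only one cell of level one, as a corner of that cell. -/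
theorem eq_of_F_eq_q {i j : Fin 3} {x : SG} (h : F j x = q i) : j = i ∧ x = q i := by
  by_cases hj : j = i
  · subst hj
    exact ⟨rfl, F_injective j (h.trans (F_q j).symm)⟩
  · exact absurd (q_injective (eq_q_of_F_eq_F (Ne.symm hj) ((F_q i).trans h.symm))).symm hj

/-! ### Functions glued from the three cells of level one -/

/-- The function that is `u i` on the cell `F_i SG`, read in the coordinates of the cell.
At a point of two cells one of the two is chosen. -/
def glue {X : Type*} (u : Fin 3 → SG → X) (x : SG) : X :=
  u (exists_F_eq x).choose (exists_F_eq x).choose_spec.choose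

theorem glue_F {X : Type*} {u : Fin 3 → SG → X} (hu : ∀ i j, u i (q j) = u j (q i))
    (i : Fin 3) (x : SG) : glue u (F i x) = u i x := by
  have h := (exists_F_eq (F i x)).choose_spec.choose_spec
  unfold glue
  generalize (exists_F_eq (F i x)).choose_spec.choose = y at h ⊢
  generalize (exists_F_eq (F i x)).choose = j at h ⊢
  by_cases hij : i = j
  · subst hij
    rw [F_injective i h]
  · rw [eq_q_of_F_eq_F hij h.symm, eq_q_of_F_eq_F (Ne.symm hij) h, hu]

theorem continuous_of_continuous_comp_F {X : Type*} [TopologicalSpace X] {v : SG → X}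
    (hv : ∀ i, Continuous fun x => v (F i x)) : Continuous v := by
  refine continuous_iff_isClosed.2 fun s hs => ?_
  have : v ⁻¹' s = ⋃ i, F i '' ((fun x => v (F i x)) ⁻¹' s) := by
    ext x
    obtain ⟨i, y, rfl⟩ := exists_F_eq x
    simp only [Set.mem_preimage, Set.mem_iUnion, Set.mem_image]
    exact ⟨fun h => ⟨i, y, h, rfl⟩, fun ⟨j, z, hz, h⟩ => h ▸ hz⟩
  rw [this]
  exact isClosed_iUnion_of_finite fun i =>
    (((hs.preimage (hv i)).isCompact).image (continuous_F i)).isClosed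

/-! ### Self-similarity of the measure -/

theorem continuous_coding : Continuous coding :=
  Continuous.subtype_mk continuous_codingPlane _

theorem measurable_coding : Measurable coding := continuous_coding.measurable

/-- The uniform distribution of one digit. -/
abbrev digitMeasure : Measure (Fin 3) := (PMF.uniformOfFintype (Fin 3)).toMeasure

instance : IsProbabilityMeasure stdMeasure :=
  Measure.isProbabilityMeasure_map measurable_coding.aemeasurable

theorem coding_cons (i : Fin 3) (ω : ℕ → Fin 3) :
    coding (fun n => Nat.casesOn n i ω) = F i (coding ω) :=
  Subtype.ext (codingPlane_eq _)

theorem measurable_cons (i : Fin 3) :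
    Measurable fun (ω : ℕ → Fin 3) (n : ℕ) => (Nat.casesOn n i ω : Fin 3) := by
  refine measurable_pi_iff.2 fun n => ?_
  cases n with
  | zero => exact measurable_const
  | succ n => exact measurable_pi_apply n

/-- A sequence of independent uniform digits consists of a uniform first digit and an independent
sequence of the same law. -/
theorem sum_map_cons :
    (Measure.infinitePi fun _ : ℕ => digitMeasure) =
      ∑ i : Fin 3, (3 : ENNReal)⁻¹ • (Measure.infinitePi fun _ : ℕ => digitMeasure).map
        (fun (ω : ℕ → Fin 3) (n : ℕ) => (Nat.casesOn n i ω : Fin 3)) := by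
  symm
  apply Measure.eq_infinitePi
  intro s t ht
  -- the box may be taken over an initial segment of the indices
  obtain ⟨N, hN⟩ : ∃ N, s ⊆ Finset.range (N + 1) :=
    ⟨s.sup id, fun n hn => Finset.mem_range.2 (Nat.lt_succ_of_le (Finset.le_sup (f := id) hn))⟩
  let t' : ℕ → Set (Fin 3) := fun n => if n ∈ s then t n else Set.univ
  have hpi : Set.pi (s : Set ℕ) t = Set.pi (Finset.range (N + 1) : Set ℕ) t' := by
    ext ω
    simp only [Set.mem_pi, Finset.mem_coe, t']
    constructor
    · intro h n _
      split_ifs with hn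
      · exact h n hn
      · trivial
    · intro h n hn
      simpa [hn] using h n (hN hn)
  have hprod : ∏ n ∈ s, digitMeasure (t n) = ∏ n ∈ Finset.range (N + 1), digitMeasure (t' n) := by
    rw [← Finset.prod_subset hN]
    · exact Finset.prod_congr rfl fun n hn => by simp [t', hn]
    · intro n _ hn
      simp [t', hn]
  have hcell : ∀ i : Fin 3, (Measure.infinitePi fun _ : ℕ => digitMeasure)
      ((fun (ω : ℕ → Fin 3) (n : ℕ) => (Nat.casesOn n i ω : Fin 3)) ⁻¹'
        Set.pi (Finset.range (N + 1) : Set ℕ) t') =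
      (t' 0).indicator (fun _ => ∏ n ∈ Finset.range N, digitMeasure (t' (n + 1))) i := by
    intro i
    by_cases hi : i ∈ t' 0
    · rw [Set.indicator_of_mem hi,
        ← Measure.infinitePi_pi (fun _ : ℕ => digitMeasure) fun _ _ => MeasurableSet.of_discrete]
      congr 1
      ext ω
      simp only [Set.mem_preimage, Set.mem_pi, Finset.mem_coe, Finset.mem_range]
      exact ⟨fun h n hn => h (n + 1) (by omega), fun h n hn => by
        cases n with
        | zero => exact hi
        | succ n => exact h n (by omega)⟩
    · rw [Set.indicator_of_notMem hi]
      refine (congrArg _ ?_).trans measure_empty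
      ext ω
      simp only [Set.mem_preimage, Set.mem_pi, Finset.mem_coe, Finset.mem_range,
        Set.mem_empty_iff_false, iff_false]
      exact fun h => hi (h 0 (by omega))
  rw [hpi, hprod, Finset.prod_range_succ', Measure.coe_finsetSum, Finset.sum_apply]
  simp only [Measure.smul_apply, smul_eq_mul]
  have hm : MeasurableSet (Set.pi (Finset.range (N + 1) : Set ℕ) t') :=
    MeasurableSet.pi (Finset.countable_toSet _) fun _ _ => MeasurableSet.of_discrete
  simp_rw [Measure.map_apply (measurable_cons _) hm, hcell]
  rw [digitMeasure, PMF.toMeasure_apply_fintype, Finset.mul_sum]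
  refine Finset.sum_congr rfl fun i _ => ?_
  by_cases hi : i ∈ t' 0
  · simp [hi, mul_comm]
  · simp [hi]

theorem stdMeasure_eq : stdMeasure = ∑ i : Fin 3, (3 : ENNReal)⁻¹ • stdMeasure.map (F i) := by
  conv_lhs => rw [stdMeasure, sum_map_cons]
  rw [← Measure.mapₗ_apply_of_measurable measurable_coding, map_sum]
  refine Finset.sum_congr rfl fun i _ => ?_
  rw [map_smul, Measure.mapₗ_apply_of_measurable measurable_coding, stdMeasure,
    Measure.map_map measurable_coding (measurable_cons i),
    Measure.map_map (continuous_F i).measurable measurable_coding]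
  congr 2
  funext ω
  exact coding_cons i ω

theorem integrable_of_continuous {f : SG → ℝ} (hf : Continuous f) : Integrable f stdMeasure :=
  integrableOn_univ.1 (hf.continuousOn.integrableOn_compact isCompact_univ)

theorem integral_eq_sum_cells {f : SG → ℝ} (hf : Continuous f) :
    ∫ x, f x ∂stdMeasure = (1 / 3) * ∑ i, ∫ x, f (F i x) ∂stdMeasure := by
  have hint : ∀ i ∈ Finset.univ, Integrable f ((3 : ENNReal)⁻¹ • stdMeasure.map (F i)) := by
    intro i _
    have : IsFiniteMeasure (stdMeasure.map (F i)) := inferInstance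
    refine Integrable.smul_measure ?_ (by simp)
    exact (integrable_map_measure hf.aestronglyMeasurable (continuous_F i).aemeasurable).2
      (integrable_of_continuous (hf.comp (continuous_F i)))
  conv_lhs => rw [stdMeasure_eq]
  rw [integral_finsetSum_measure hint, Finset.mul_sum]
  refine Finset.sum_congr rfl fun i _ => ?_
  rw [integral_smul_measure, integral_map (continuous_F i).aemeasurable hf.aestronglyMeasurable]
  simp

theorem stdMeasure_apply {s : Set SG} (hs : MeasurableSet s) :
    stdMeasure s = ∑ i, 3⁻¹ * stdMeasure (F i ⁻¹' s) := by
  conv_lhs => rw [stdMeasure_eq]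
  simp [Measure.map_apply (continuous_F _).measurable hs]

theorem stdMeasure_q (i : Fin 3) : stdMeasure {q i} = 0 := by
  have h := stdMeasure_apply (measurableSet_singleton (q i))
  have hi : ∀ j, F j ⁻¹' {q i} = if j = i then {q i} else ∅ := by
    intro j
    ext x
    simp only [Set.mem_preimage, Set.mem_singleton_iff]
    split_ifs with hj
    · subst hj
      exact ⟨fun h => (eq_of_F_eq_q h).2, fun h => by rw [Set.mem_singleton_iff.1 h, F_q]⟩
    · exact ⟨fun h => hj (eq_of_F_eq_q h).1, fun h => h.elim⟩
  have hs : ∀ j, stdMeasure (F j ⁻¹' {q i}) = if j = i then stdMeasure {q i} else 0 := by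
    intro j
    rw [hi]
    split_ifs <;> simp
  simp only [hs, mul_ite, mul_zero, Finset.sum_ite_eq', Finset.mem_univ, if_true] at h
  have hfin : stdMeasure {q i} ≠ ⊤ := measure_ne_top _ _
  have h' := congrArg ENNReal.toReal h
  rw [ENNReal.toReal_mul] at h'
  simp at h'
  have h0 : (stdMeasure {q i}).toReal = 0 := by linarith
  exact ((ENNReal.toReal_eq_zero_iff _).1 h0).resolve_right hfin

theorem ae_comp_F {p : SG → Prop} (h : ∀ᵐ x ∂stdMeasure, p x) (i : Fin 3) :
    ∀ᵐ x ∂stdMeasure, p (F i x) := by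
  rw [stdMeasure_eq] at h
  have h1 : ∀ᵐ x ∂(3 : ENNReal)⁻¹ • stdMeasure.map (F i), p x := by
    rw [ae_iff, Measure.coe_finsetSum, Finset.sum_apply, Finset.sum_eq_zero_iff] at h
    exact h i (Finset.mem_univ i)
  rw [ae_iff, Measure.smul_apply, smul_eq_mul, mul_eq_zero] at h1
  exact ae_of_ae_map (continuous_F i).aemeasurable (h1.resolve_left (by simp))

/-- The measure has full support. -/
theorem eq_zero_of_ae_eq_zero {f : SG → ℝ} (hf : Continuous f) (h : ∀ᵐ x ∂stdMeasure, f x = 0)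
    (x : SG) : f x = 0 := by
  have key : ∀ n : ℕ, ∀ f : SG → ℝ, (∀ᵐ x ∂stdMeasure, f x = 0) → ∀ x : SG,
      ∃ y, f y = 0 ∧ dist x y ≤ 2 * (1 / 2) ^ n := by
    intro n
    induction n with
    | zero =>
      intro f h x
      obtain ⟨y, hy⟩ := h.exists
      exact ⟨y, hy, by simpa using dist_le_two x y⟩
    | succ n ih =>
      intro f h x
      obtain ⟨i, x, rfl⟩ := exists_F_eq x
      obtain ⟨y, hy, hd⟩ := ih (fun x => f (F i x)) (ae_comp_F h i) x
      exact ⟨F i y, hy, by rw [dist_F, pow_succ]; linarith⟩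
  have hcl : x ∈ closure (f ⁻¹' {0}) := by
    refine Metric.mem_closure_iff.2 fun ε hε => ?_
    obtain ⟨n, hn⟩ := exists_pow_lt_of_lt_one (half_pos hε) (by norm_num : (1 / 2 : ℝ) < 1)
    obtain ⟨y, hy, hd⟩ := key n f h x
    exact ⟨y, hy, by linarith⟩
  rwa [(isClosed_singleton.preimage hf).closure_eq] at hcl

/-! ### Harmonic functions -/

/-- The values at `F_i q_0, F_i q_1, F_i q_2` of the harmonic function with boundary values `b`
(the `1/5`–`2/5` rule). -/
def harmStep (i : Fin 3) (b : Fin 3 → ℝ) (j : Fin 3) : ℝ :=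
  if j = i then b i else (b i + b j + (b 0 + b 1 + b 2)) / 5

/-- The action of `F_i` on the triple of values of the three basic harmonic functions. It is the
transpose of `harmStep i`, written on the affine plane where the triple has sum one. -/
def coordStep (i : Fin 3) (d : Fin 3 → ℝ) (k : Fin 3) : ℝ :=
  if k = i then (3 * d i + 2) / 5 else (1 - d i + d k) / 5

theorem continuous_coordStep (i : Fin 3) : Continuous (coordStep i) := by
  refine continuous_pi fun k => ?_
  unfold coordStep
  split_ifs <;> fun_prop

theorem dist_coordStep_le (i : Fin 3) (d e : Fin 3 → ℝ) :
    dist (coordStep i d) (coordStep i e) ≤ 3 / 5 * dist d e := by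
  refine (dist_pi_le_iff (by positivity)).2 fun k => ?_
  have h : ∀ j, |d j - e j| ≤ dist d e := fun j => dist_le_pi_dist d e j
  have h1 := abs_le.1 (h i)
  have h2 := abs_le.1 (h k)
  rw [Real.dist_eq, coordStep, coordStep, abs_le]
  split_ifs <;> constructor <;> linarith

/-- The continuous maps to the standard simplex that take the corners of the gasket to the
vertices. -/
def simplexMaps : Set C(SG, Fin 3 → ℝ) :=
  {h | (∀ i, h (q i) = Pi.single i 1) ∧ (∀ x, h x 0 + h x 1 + h x 2 = 1) ∧ ∀ x k, 0 ≤ h x k}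

theorem isClosed_simplexMaps : IsClosed simplexMaps := by
  have hc : ∀ (x : SG), Continuous fun h : C(SG, Fin 3 → ℝ) => h x :=
    fun x => continuous_eval_const x
  have hk : ∀ (x : SG) (k : Fin 3), Continuous fun h : C(SG, Fin 3 → ℝ) => h x k :=
    fun x k => (continuous_apply k).comp (hc x)
  have e : simplexMaps = (⋂ i, {h | h (q i) = Pi.single i 1}) ∩
      ((⋂ x, {h | h x 0 + h x 1 + h x 2 = 1}) ∩ ⋂ x, ⋂ k, {h | 0 ≤ h x k}) := by
    ext h
    simp [simplexMaps]
  rw [e]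
  refine (isClosed_iInter fun i => isClosed_eq (hc _) continuous_const).inter
    ((isClosed_iInter fun x => isClosed_eq (((hk x 0).add (hk x 1)).add (hk x 2))
      continuous_const).inter (isClosed_iInter fun x => isClosed_iInter fun k =>
        isClosed_le continuous_const (hk x k)))

instance : Nonempty simplexMaps := by
  -- barycentric coordinates
  refine ⟨⟨fun x k => bary k x, ?_⟩, ?_, fun x => bary_sum x, fun x k => bary_nonneg k x⟩
  · exact continuous_pi fun k => (continuous_bary k).comp continuous_subtype_val
  · intro i
    ext k
    simp [bary_q, Pi.single_apply]

instance : CompleteSpace simplexMaps := isClosed_simplexMaps.completeSpace_coe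

/-- The values that `F_i` and `F_j` prescribe at the common corner `F_i q_j = F_j q_i` agree. -/
theorem coordStep_compat {h : SG → Fin 3 → ℝ} (hq : ∀ i, h (q i) = Pi.single i 1) (i j : Fin 3) :
    coordStep i (h (q j)) = coordStep j (h (q i)) := by
  ext k
  simp only [coordStep, hq, Pi.single_apply]
  by_cases hij : i = j
  · subst hij; rfl
  · by_cases h1 : k = i
    · subst h1; simp [hij, Ne.symm hij]; norm_num
    · by_cases h2 : k = j
      · subst h2; simp [hij, Ne.symm hij]; norm_num
      · simp [h1, h2, hij, Ne.symm hij]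

/-- The operation on simplex maps whose fixed point is harmonic. -/
def simplexStep (h : simplexMaps) : simplexMaps :=
  have hg := glue_F (u := fun i x => coordStep i (h.1 x)) fun i j => coordStep_compat h.2.1 i j
  ⟨⟨glue fun i x => coordStep i (h.1 x), continuous_of_continuous_comp_F fun i => by
      simp only [hg]
      exact (continuous_coordStep i).comp h.1.continuous⟩, by
    have hsum := h.2.2.1
    have hnn := h.2.2.2
    refine ⟨fun i => ?_, fun x => ?_, fun x k => ?_⟩
    · conv_lhs => rw [← F_q i]
      change glue (fun i x => coordStep i (h.1 x)) (F i (q i)) = _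
      rw [hg, h.2.1]
      ext k
      by_cases hk : k = i
      · subst hk; simp [coordStep]; norm_num
      · simp [coordStep, hk]
    · obtain ⟨i, x, rfl⟩ := exists_F_eq x
      change glue (fun i x => coordStep i (h.1 x)) (F i x) 0 +
        glue (fun i x => coordStep i (h.1 x)) (F i x) 1 +
        glue (fun i x => coordStep i (h.1 x)) (F i x) 2 = 1
      simp only [hg]
      have := hsum x
      fin_cases i <;> simp [coordStep] <;> linarith
    · obtain ⟨i, x, rfl⟩ := exists_F_eq x
      change 0 ≤ glue (fun i x => coordStep i (h.1 x)) (F i x) k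
      simp only [hg, coordStep]
      have := hsum x
      have h0 := hnn x 0
      have h1 := hnn x 1
      have h2 := hnn x 2
      have h3 := hnn x k
      split_ifs <;> fin_cases i <;> simp at * <;> linarith⟩

theorem simplexStep_F (h : simplexMaps) (i : Fin 3) (x : SG) :
    (simplexStep h).1 (F i x) = coordStep i (h.1 x) :=
  glue_F (u := fun i x => coordStep i (h.1 x)) (fun i j => coordStep_compat h.2.1 i j) i x

theorem contracting_simplexStep : ContractingWith (3 / 5) simplexStep := by
  refine ⟨by rw [div_lt_one (by norm_num)]; norm_num, LipschitzWith.of_dist_le_mul fun g h => ?_⟩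
  change dist (simplexStep g).1 (simplexStep h).1 ≤ _ * dist g.1 h.1
  refine (ContinuousMap.dist_le (by positivity)).2 fun x => ?_
  obtain ⟨i, x, rfl⟩ := exists_F_eq x
  rw [simplexStep_F, simplexStep_F]
  refine (dist_coordStep_le i _ _).trans ?_
  have : ((3 / 5 : NNReal) : ℝ) = 3 / 5 := by norm_num
  rw [this]
  gcongr
  exact ContinuousMap.dist_apply_le_dist x

/-- The harmonic function on the gasket with value one at `q_k` and zero at the other two
corners. -/
def harmBasis (k : Fin 3) (x : SG) : ℝ :=
  (ContractingWith.fixedPoint simplexStep contracting_simplexStep).1 x k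

theorem continuous_harmBasis (k : Fin 3) : Continuous (harmBasis k) :=
  (continuous_apply k).comp (ContinuousMap.continuous _)

theorem harmBasis_q (k i : Fin 3) : harmBasis k (q i) = if k = i then 1 else 0 := by
  rw [harmBasis, (ContractingWith.fixedPoint simplexStep contracting_simplexStep).2.1,
    Pi.single_apply]

theorem harmBasis_sum (x : SG) : harmBasis 0 x + harmBasis 1 x + harmBasis 2 x = 1 :=
  (ContractingWith.fixedPoint simplexStep contracting_simplexStep).2.2.1 x

theorem harmBasis_nonneg (k : Fin 3) (x : SG) : 0 ≤ harmBasis k x :=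
  (ContractingWith.fixedPoint simplexStep contracting_simplexStep).2.2.2 x k

theorem harmBasis_F (k i : Fin 3) (x : SG) :
    harmBasis k (F i x) =
      if k = i then (3 * harmBasis i x + 2) / 5 else (1 - harmBasis i x + harmBasis k x) / 5 := by
  have h : simplexStep (ContractingWith.fixedPoint simplexStep contracting_simplexStep) =
      ContractingWith.fixedPoint simplexStep contracting_simplexStep :=
    contracting_simplexStep.fixedPoint_isFixedPt
  conv_lhs => rw [harmBasis, ← h, simplexStep_F]
  rfl

/-- The harmonic function with boundary values `b`. -/
def harm (b : Fin 3 → ℝ) (x : SG) : ℝ := ∑ k, b k * harmBasis k x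

theorem continuous_harm (b : Fin 3 → ℝ) : Continuous (harm b) :=
  continuous_finsetSum _ fun k _ => continuous_const.mul (continuous_harmBasis k)

theorem harm_q (b : Fin 3 → ℝ) (i : Fin 3) : harm b (q i) = b i := by
  simp [harm, harmBasis_q]

/-- Self-similarity of harmonic functions; here `coordStep i` is seen to be the transpose of
`harmStep i`. -/
theorem harm_F (b : Fin 3 → ℝ) (i : Fin 3) (x : SG) :
    harm b (F i x) = harm (harmStep i b) x := by
  have h := harmBasis_sum x
  have h0 : harmBasis 0 x = 1 - harmBasis 1 x - harmBasis 2 x := by linarith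
  simp only [harm, Fin.sum_univ_three, harmBasis_F]
  fin_cases i <;> simp [harmStep] <;> rw [h0] <;> ring

/-- The maximum principle. -/
theorem abs_harm_sub_le {b : Fin 3 → ℝ} {c ε : ℝ} (hb : ∀ k, |b k - c| ≤ ε) (x : SG) :
    |harm b x - c| ≤ ε := by
  have h := harmBasis_sum x
  have e : harm b x - c = ∑ k, (b k - c) * harmBasis k x := by
    simp only [harm, Fin.sum_univ_three]
    linear_combination c * h
  rw [e]
  refine (Finset.abs_sum_le_sum_abs _ _).trans ?_
  calc ∑ k, |(b k - c) * harmBasis k x| ≤ ∑ k, ε * harmBasis k x := by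
        refine Finset.sum_le_sum fun k _ => ?_
        rw [abs_mul, abs_of_nonneg (harmBasis_nonneg k x)]
        exact mul_le_mul_of_nonneg_right (hb k) (harmBasis_nonneg k x)
    _ = ε := by rw [← Finset.mul_sum, Fin.sum_univ_three, h, mul_one]

/-! ### Harmonic splines -/

/-- The continuous function that agrees with `u` on `V_n` and is harmonic in every cell of
level `n`. -/
def spline : ℕ → (SG → ℝ) → SG → ℝ
  | 0, u => harm fun i => u (q i)
  | n + 1, u => glue fun i => spline n fun x => u (F i x)

theorem spline_q (n : ℕ) : ∀ (u : SG → ℝ) (i : Fin 3), spline n u (q i) = u (q i) := by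
  induction n with
  | zero => exact fun u i => harm_q _ i
  | succ n ih =>
    intro u i
    conv_lhs => rw [← F_q i]
    rw [spline, glue_F (fun i j => by rw [ih, ih, F_q_comm]), ih, F_q]

theorem spline_succ_F (n : ℕ) (u : SG → ℝ) (i : Fin 3) (x : SG) :
    spline (n + 1) u (F i x) = spline n (fun y => u (F i y)) x := by
  rw [spline, glue_F fun i j => by rw [spline_q, spline_q, F_q_comm]]

theorem continuous_spline (n : ℕ) : ∀ u : SG → ℝ, Continuous (spline n u) := by
  induction n with
  | zero => exact fun u => continuous_harm _
  | succ n ih =>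
    refine fun u => continuous_of_continuous_comp_F fun i => ?_
    simp only [spline_succ_F]
    exact ih _

theorem spline_cellMap (n : ℕ) : ∀ (u : SG → ℝ) (w : Fin n → Fin 3) (x : SG),
    spline n u (cellMap n w x) = harm (fun i => u (cellMap n w (q i))) x := by
  induction n with
  | zero => exact fun u w x => rfl
  | succ n ih =>
    intro u w x
    exact (spline_succ_F n u (w 0) _).trans (ih _ _ x)

theorem spline_eq_on_V {n : ℕ} (u : SG → ℝ) {z : SG} (hz : z ∈ V n) : spline n u z = u z := by
  classical
  obtain ⟨⟨w, j⟩, -, rfl⟩ := Finset.mem_image.1 hz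
  rw [spline_cellMap, harm_q]

theorem cellMap_q_mem_V {n : ℕ} (w : Fin n → Fin 3) (j : Fin 3) : cellMap n w (q j) ∈ V n := by
  classical
  exact Finset.mem_image.2 ⟨(w, j), Finset.mem_univ _, rfl⟩

theorem exists_cellMap_eq (n : ℕ) : ∀ x : SG, ∃ w y, cellMap n w y = x := by
  induction n with
  | zero => exact fun x => ⟨Fin.elim0, x, rfl⟩
  | succ n ih =>
    intro x
    obtain ⟨i, y, rfl⟩ := exists_F_eq x
    obtain ⟨w, y, rfl⟩ := ih y
    exact ⟨Fin.cons i w, y, cellMap_cons n i w y⟩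

theorem spline_congr {n : ℕ} {u v : SG → ℝ} (h : ∀ z ∈ V n, u z = v z) :
    spline n u = spline n v := by
  funext x
  obtain ⟨w, y, rfl⟩ := exists_cellMap_eq n x
  rw [spline_cellMap, spline_cellMap]
  simp only [h _ (cellMap_q_mem_V w _)]

theorem spline_add_smul (n : ℕ) (u v : SG → ℝ) (t : ℝ) (x : SG) :
    spline n (fun y => u y + t * v y) x = spline n u x + t * spline n v x := by
  obtain ⟨w, y, rfl⟩ := exists_cellMap_eq n x
  simp only [spline_cellMap, harm, Fin.sum_univ_three]
  ring

theorem spline_harm (n : ℕ) : ∀ b : Fin 3 → ℝ, spline n (harm b) = harm b := by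
  induction n with
  | zero => intro b; simp only [spline, harm_q]
  | succ n ih =>
    intro b
    funext x
    obtain ⟨i, x, rfl⟩ := exists_F_eq x
    rw [spline_succ_F]
    simp only [harm_F]
    rw [ih]

theorem spline_spline {n N : ℕ} (h : n ≤ N) (u : SG → ℝ) :
    spline N (spline n u) = spline n u := by
  induction n generalizing N u with
  | zero => exact spline_harm N _
  | succ n ih =>
    obtain ⟨N, rfl⟩ : ∃ k, N = k + 1 := ⟨N - 1, by omega⟩
    funext x
    obtain ⟨i, x, rfl⟩ := exists_F_eq x
    rw [spline_succ_F, spline_succ_F]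
    simp only [spline_succ_F]
    rw [ih (by omega)]

theorem V_mono {n N : ℕ} (h : n ≤ N) : V n ⊆ V N := by
  classical
  induction n generalizing N with
  | zero =>
    intro z hz
    obtain ⟨⟨w, j⟩, -, rfl⟩ := Finset.mem_image.1 hz
    have : ∀ N, cellMap N (fun _ => j) (q j) = q j := by
      intro N
      induction N with
      | zero => rfl
      | succ N ih => exact (congrArg (F j) ih).trans (F_q j)
    exact Finset.mem_image.2 ⟨(fun _ => j, j), Finset.mem_univ _, this N⟩
  | succ n ih =>
    obtain ⟨N, rfl⟩ : ∃ k, N = k + 1 := ⟨N - 1, by omega⟩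
    intro z hz
    obtain ⟨⟨w, j⟩, -, rfl⟩ := Finset.mem_image.1 hz
    obtain ⟨⟨w', j'⟩, -, h'⟩ := Finset.mem_image.1
      (ih (N := N) (by omega) (cellMap_q_mem_V (fun k => w k.succ) j))
    refine Finset.mem_image.2 ⟨(Fin.cons (w 0) w', j'), Finset.mem_univ _, ?_⟩
    exact (cellMap_cons _ _ _ _).trans (congrArg (F (w 0)) h')

/-- Cells of level `n` have diameter at most `2 * (1 / 2) ^ n`, and a spline takes values in the
convex hull of its values at the corners of the cell. -/
theorem abs_spline_sub_le {ε : ℝ} (n : ℕ) : ∀ (v : SG → ℝ)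
    (_ : ∀ x y, dist x y ≤ 2 * (1 / 2) ^ n → |v x - v y| ≤ ε) (x : SG),
    |spline n v x - v x| ≤ ε := by
  induction n with
  | zero =>
    intro v hv x
    exact abs_harm_sub_le (fun k => hv _ _ (by simpa using dist_le_two _ _)) x
  | succ n ih =>
    intro v hv x
    obtain ⟨i, x, rfl⟩ := exists_F_eq x
    rw [spline_succ_F]
    refine ih _ (fun x y hxy => hv _ _ ?_) x
    rw [dist_F, pow_succ]
    linarith

/-- The harmonic splines that interpolate a continuous function converge to it uniformly. -/
theorem eventually_abs_spline_sub_le {v : SG → ℝ} (hv : Continuous v) {ε : ℝ} (hε : 0 < ε) :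
    ∀ᶠ n in atTop, ∀ x, |spline n v x - v x| ≤ ε := by
  obtain ⟨δ, hδ, h⟩ := Metric.uniformContinuous_iff.1
    (CompactSpace.uniformContinuous_of_continuous hv) ε hε
  have ht : Tendsto (fun n : ℕ => 2 * (1 / 2 : ℝ) ^ n) atTop (𝓝 (2 * 0)) :=
    (tendsto_pow_atTop_nhds_zero_of_lt_one (by norm_num) (by norm_num)).const_mul 2
  rw [mul_zero] at ht
  filter_upwards [ht.eventually (gt_mem_nhds hδ)] with n hn x
  exact abs_spline_sub_le n v (fun x y hxy => (h (hxy.trans_lt hn)).le) x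

theorem tendsto_integral_mul_spline {f v : SG → ℝ} (hf : Integrable f stdMeasure)
    (hv : Continuous v) :
    Tendsto (fun n => ∫ x, f x * spline n v x ∂stdMeasure) atTop
      (𝓝 (∫ x, f x * v x ∂stdMeasure)) := by
  obtain ⟨C, hC⟩ := isCompact_univ.exists_bound_of_continuousOn hv.continuousOn
  refine tendsto_integral_filter_of_dominated_convergence (fun x => ‖f x‖ * (1 + C)) ?_ ?_ ?_ ?_
  · exact Eventually.of_forall fun n =>
      hf.aestronglyMeasurable.mul (continuous_spline n v).aestronglyMeasurable
  · filter_upwards [eventually_abs_spline_sub_le hv one_pos] with n hn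
    refine Eventually.of_forall fun x => ?_
    rw [norm_mul]
    gcongr
    have h1 := hC x (Set.mem_univ x)
    have h2 := abs_sub_abs_le_abs_sub (spline n v x) (v x)
    have h3 := hn x
    rw [Real.norm_eq_abs] at h1 ⊢
    linarith
  · exact hf.norm.mul_const _
  · refine Eventually.of_forall fun x => tendsto_const_nhds.mul ?_
    refine Metric.tendsto_nhds.2 fun ε hε => ?_
    filter_upwards [eventually_abs_spline_sub_le hv (half_pos hε)] with n hn
    rw [Real.dist_eq]
    linarith [hn x]

/-! ### The graph energies of splines -/

theorem graphEnergy_zero (u v : SG → ℝ) :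
    graphEnergy 0 u v = ∑ i : Fin 3, (u (q i) - u (q (i + 1))) * (v (q i) - v (q (i + 1))) := by
  simp [graphEnergy, cellMap]

theorem graphEnergy_succ (n : ℕ) (u v : SG → ℝ) :
    graphEnergy (n + 1) u v =
      5 / 3 * ∑ i, graphEnergy n (fun x => u (F i x)) (fun x => v (F i x)) := by
  simp only [graphEnergy]
  rw [← (Fin.consEquiv fun _ => Fin 3).sum_comp, Fintype.sum_prod_type]
  simp only [cellMap_consEquiv]
  rw [← Finset.mul_sum, pow_succ]
  ring

theorem graphEnergy_comm (n : ℕ) (u v : SG → ℝ) : graphEnergy n u v = graphEnergy n v u := by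
  simp only [graphEnergy, mul_comm]

theorem graphEnergy_self_nonneg (n : ℕ) (u : SG → ℝ) : 0 ≤ graphEnergy n u u :=
  mul_nonneg (by positivity) (Finset.sum_nonneg fun _ _ => Finset.sum_nonneg fun _ _ =>
    mul_self_nonneg _)

theorem graphEnergy_add_smul (n : ℕ) (u v v' : SG → ℝ) (t : ℝ) :
    graphEnergy n u (fun x => v x + t * v' x) = graphEnergy n u v + t * graphEnergy n u v' := by
  simp only [graphEnergy]
  rw [mul_left_comm t, ← mul_add]
  congr 1
  rw [Finset.mul_sum, ← Finset.sum_add_distrib]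
  refine Finset.sum_congr rfl fun w _ => ?_
  rw [Finset.mul_sum, ← Finset.sum_add_distrib]
  refine Finset.sum_congr rfl fun i _ => ?_
  ring

theorem graphEnergy_add_smul_left (n : ℕ) (u u' v : SG → ℝ) (t : ℝ) :
    graphEnergy n (fun x => u x + t * u' x) v = graphEnergy n u v + t * graphEnergy n u' v := by
  rw [graphEnergy_comm, graphEnergy_add_smul, graphEnergy_comm, graphEnergy_comm n v u']

theorem graphEnergy_congr {n : ℕ} {u u' v v' : SG → ℝ} (h : ∀ z ∈ V n, u z = u' z)
    (h' : ∀ z ∈ V n, v z = v' z) : graphEnergy n u v = graphEnergy n u' v' := by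
  simp only [graphEnergy, h _ (cellMap_q_mem_V _ _), h' _ (cellMap_q_mem_V _ _)]

/-- The energy of a harmonic function against any function sees only the boundary values. -/
theorem graphEnergy_harm (n : ℕ) : ∀ (b : Fin 3 → ℝ) (v : SG → ℝ),
    graphEnergy n (harm b) v =
      ∑ i : Fin 3, (b i - b (i + 1)) * (v (q i) - v (q (i + 1))) := by
  induction n with
  | zero => intro b v; simp only [graphEnergy_zero, harm_q]
  | succ n ih =>
    intro b v
    rw [graphEnergy_succ]
    simp only [harm_F]
    have e : ∀ i, graphEnergy n (fun x => harm (harmStep i b) x) (fun x => v (F i x)) = _ :=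
      fun i => ih (harmStep i b) fun x => v (F i x)
    simp only [e, Fin.sum_univ_three]
    simp only [harmStep, F_q, F_q_comm 1 0, F_q_comm 2 0, F_q_comm 2 1, Fin.isValue,
      show (0 : Fin 3) + 1 = 1 from rfl, show (1 : Fin 3) + 1 = 2 from rfl,
      show (2 : Fin 3) + 1 = 0 from rfl]
    simp
    ring

/-- A spline of level `n` has the same energy against any function at all levels from `n` on. -/
theorem graphEnergy_spline {n N : ℕ} (h : n ≤ N) (u v : SG → ℝ) :
    graphEnergy N (spline n u) v = graphEnergy n u v := by
  induction n generalizing N u v with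
  | zero => rw [graphEnergy_zero]; exact graphEnergy_harm N _ v
  | succ n ih =>
    obtain ⟨N, rfl⟩ : ∃ k, N = k + 1 := ⟨N - 1, by omega⟩
    rw [graphEnergy_succ, graphEnergy_succ]
    simp only [spline_succ_F]
    congr 1
    exact Finset.sum_congr rfl fun i _ => ih (by omega) _ _

/-- The energy of level `N` of `u` minus that of level `n` is the energy of level `N` of
`u - spline n u`. -/
theorem graphEnergy_mono {n N : ℕ} (h : n ≤ N) (u : SG → ℝ) :
    graphEnergy n u u ≤ graphEnergy N u u := by
  have h0 := graphEnergy_self_nonneg N fun x => u x + (-1) * spline n u x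
  rw [graphEnergy_add_smul, graphEnergy_add_smul_left, graphEnergy_add_smul_left,
    graphEnergy_comm N u (spline n u), graphEnergy_spline h, graphEnergy_spline h,
    graphEnergy_comm n u (spline n u), graphEnergy_spline le_rfl] at h0
  linarith

theorem memDomE_spline (n : ℕ) (u : SG → ℝ) : MemDomE (spline n u) := by
  refine ⟨continuous_spline n u, ⟨graphEnergy n u u, ?_⟩⟩
  rintro _ ⟨N, rfl⟩
  calc graphEnergy N (spline n u) (spline n u)
      ≤ graphEnergy (max n N) (spline n u) (spline n u) := graphEnergy_mono (le_max_right _ _) _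
    _ = graphEnergy n u u := by
      rw [graphEnergy_spline (le_max_left _ _), graphEnergy_comm, graphEnergy_spline le_rfl]

theorem graphEnergy_comp_F_le (n : ℕ) (u : SG → ℝ) (i : Fin 3) :
    graphEnergy n (fun x => u (F i x)) (fun x => u (F i x)) ≤ 3 / 5 * graphEnergy (n + 1) u u := by
  rw [graphEnergy_succ]
  have := Finset.single_le_sum
    (f := fun i => graphEnergy n (fun x => u (F i x)) (fun x => u (F i x)))
    (fun i _ => graphEnergy_self_nonneg n _) (Finset.mem_univ i)
  linarith

theorem sq_sub_le_graphEnergy_zero (u : SG → ℝ) (i j : Fin 3) :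
    (u (q i) - u (q j)) ^ 2 ≤ graphEnergy 0 u u := by
  rw [graphEnergy_zero]
  simp only [Fin.sum_univ_three,
      show (0 : Fin 3) + 1 = 1 from rfl, show (1 : Fin 3) + 1 = 2 from rfl,
      show (2 : Fin 3) + 1 = 0 from rfl]
  have h0 := mul_self_nonneg (u (q 0) - u (q 1))
  have h1 := mul_self_nonneg (u (q 1) - u (q 2))
  have h2 := mul_self_nonneg (u (q 2) - u (q 0))
  fin_cases i <;> fin_cases j <;> simp <;> nlinarith

/-- A spline is bounded by its energy, uniformly in the level. The constant `4` works since
`5 √(3/5) ≤ 4`. -/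
theorem abs_spline_sub_le_sqrt (n : ℕ) : ∀ (u : SG → ℝ) (x : SG),
    |spline n u x - u (q 0)| ≤ 4 * √(graphEnergy n u u) := by
  induction n with
  | zero =>
    intro u x
    have h : |spline 0 u x - u (q 0)| ≤ √(graphEnergy 0 u u) :=
      abs_harm_sub_le (fun k => Real.abs_le_sqrt (sq_sub_le_graphEnergy_zero u k 0)) x
    linarith [Real.sqrt_nonneg (graphEnergy 0 u u)]
  | succ n ih =>
    intro u x
    obtain ⟨i, x, rfl⟩ := exists_F_eq x
    have h1 := ih (fun y => u (F i y)) x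
    have hs : √(3 / 5 : ℝ) ≤ 4 / 5 := Real.sqrt_le_iff.2 ⟨by norm_num, by norm_num⟩
    have hk : ∀ j, √(graphEnergy n (fun x => u (F j x)) (fun x => u (F j x))) ≤
        4 / 5 * √(graphEnergy (n + 1) u u) := by
      intro j
      refine (Real.sqrt_le_sqrt (graphEnergy_comp_F_le n u j)).trans ?_
      rw [Real.sqrt_mul (by norm_num)]
      gcongr
    -- `F_i q_0 = F_0 q_i` is a neighbour of `q_0 = F_0 q_0` in the cell of `F_0`
    have h2 : |u (F i (q 0)) - u (q 0)| ≤ 4 / 5 * √(graphEnergy (n + 1) u u) := by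
      refine le_trans (Real.abs_le_sqrt ?_) (hk 0)
      have h3 := sq_sub_le_graphEnergy_zero (fun x => u (F 0 x)) i 0
      simp only [F_q] at h3
      rw [F_q_comm]
      exact h3.trans (graphEnergy_mono (Nat.zero_le n) _)
    rw [spline_succ_F]
    have h4 := hk i
    have h5 := abs_sub_le (spline n (fun y => u (F i y)) x) (u (F i (q 0))) (u (q 0))
    linarith

/-- The splines that interpolate a function of finite energy form a Cauchy sequence. -/
theorem abs_spline_sub_spline_le {n N : ℕ} (h : n ≤ N) (u : SG → ℝ) {K : ℝ}
    (hK : ∀ k, graphEnergy k u u ≤ K) (x : SG) :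
    |spline N u x - spline n u x| ≤ 8 * √((3 / 5) ^ n * K) := by
  induction n generalizing N u K x with
  | zero =>
    have h1 := abs_spline_sub_le_sqrt N u x
    have h2 := abs_spline_sub_le_sqrt 0 u x
    have h3 := Real.sqrt_le_sqrt (hK N)
    have h4 := Real.sqrt_le_sqrt (hK 0)
    rw [pow_zero, one_mul]
    rw [abs_le] at *
    constructor <;> linarith
  | succ n ih =>
    obtain ⟨N, rfl⟩ : ∃ k, N = k + 1 := ⟨N - 1, by omega⟩
    obtain ⟨i, x, rfl⟩ := exists_F_eq x
    rw [spline_succ_F, spline_succ_F]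
    have := ih (N := N) (by omega) (fun y => u (F i y)) (K := 3 / 5 * K)
      (fun k => (graphEnergy_comp_F_le k u i).trans (by linarith [hK (k + 1)])) x
    rwa [pow_succ, mul_assoc]

/-- On the functions that vanish on the boundary the energy is definite. -/
theorem eq_zero_of_graphEnergy_eq_zero {n : ℕ} {u : SG → ℝ} (hu : ∀ i, u (q i) = 0)
    (h : graphEnergy n u u = 0) {z : SG} (hz : z ∈ V n) : u z = 0 := by
  have h1 := abs_spline_sub_le_sqrt n u z
  rw [h, hu, Real.sqrt_zero, mul_zero, sub_zero, spline_eq_on_V u hz] at h1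
  exact abs_nonpos_iff.1 h1

/-! ### The Dirichlet problem -/

theorem eq_zero_of_mem_V_zero {u : SG → ℝ} (hu : ∀ i, u (q i) = 0) {z : SG} (hz : z ∈ V 0) :
    u z = 0 := by
  classical
  obtain ⟨⟨w, j⟩, -, rfl⟩ := Finset.mem_image.1 hz
  exact hu j

theorem q_mem_V_zero (i : Fin 3) : q i ∈ V 0 := cellMap_q_mem_V Fin.elim0 i

theorem mem_innerV {n : ℕ} {z : SG} : z ∈ innerV n ↔ z ∈ V n ∧ z ∉ V 0 := by
  classical
  exact Finset.mem_sdiff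

/-- Linear functionals on functions on `V_n \ V_0` are represented by a definite form. Functions on
`V_n \ V_0` are encoded as functions on the gasket that vanish elsewhere. -/
theorem exists_forall_eq_of_definite (n : ℕ) (B : (SG → ℝ) → (SG → ℝ) → ℝ) (l : (SG → ℝ) → ℝ)
    (hB : ∀ u v, B u v = B v u)
    (hlin : ∀ u v v' t, B u (fun x => v x + t * v' x) = B u v + t * B u v')
    (hdef : ∀ u, (∀ z, z ∉ innerV n → u z = 0) → B u u = 0 → ∀ z ∈ innerV n, u z = 0)
    (hBc : ∀ u v v', (∀ z ∈ V n, v z = v' z) → B u v = B u v')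
    (hl : ∀ v v' t, l (fun x => v x + t * v' x) = l v + t * l v')
    (hlc : ∀ v v', (∀ z ∈ V n, v z = v' z) → l v = l v') :
    ∃ c : SG → ℝ, (∀ z, z ∉ innerV n → c z = 0) ∧
      ∀ v : SG → ℝ, (∀ i, v (q i) = 0) → B c v = l v := by
  classical
  have toLin : ∀ f : (SG → ℝ) → ℝ, (∀ v v' t, f (fun x => v x + t * v' x) = f v + t * f v') →
      (∀ v v', f (v + v') = f v + f v') ∧ ∀ (t : ℝ) v, f (t • v) = t • f v := by
    intro f hf
    have h1 : ∀ v v', f (v + v') = f v + f v' := by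
      intro v v'
      have := hf v v' 1
      simp only [one_mul] at this
      exact this
    have h0 : f (fun _ => 0) = 0 := by
      have := hf (fun _ => 0) (fun _ => 0) 1
      simp only [mul_zero, add_zero, one_mul] at this
      linarith
    refine ⟨h1, fun t v => ?_⟩
    have := hf (fun _ => 0) v t
    simp only [zero_add, h0] at this
    exact this
  let B' : (SG → ℝ) →ₗ[ℝ] (SG → ℝ) →ₗ[ℝ] ℝ := LinearMap.mk₂ ℝ B
    (fun u u' v => by rw [hB, (toLin _ (hlin v)).1, hB v, hB v])
    (fun t u v => by rw [hB, (toLin _ (hlin v)).2, hB v])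
    (fun u v v' => (toLin _ (hlin u)).1 v v') (fun t u v => (toLin _ (hlin u)).2 t v)
  let l' : (SG → ℝ) →ₗ[ℝ] ℝ := ⟨⟨l, (toLin l hl).1⟩, (toLin l hl).2⟩
  let Z : ({z // z ∈ innerV n} → ℝ) →ₗ[ℝ] (SG → ℝ) :=
    { toFun := fun y z => if h : z ∈ innerV n then y ⟨z, h⟩ else 0
      map_add' := fun y y' => by
        funext z
        by_cases h : z ∈ innerV n <;> simp [h]
      map_smul' := fun t y => by
        funext z
        by_cases h : z ∈ innerV n <;> simp [h] }
  have hZ : ∀ y (z : SG) (h : z ∈ innerV n), Z y z = y ⟨z, h⟩ := fun y z h => dif_pos h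
  have hZ' : ∀ y (z : SG) (_ : z ∉ innerV n), Z y z = 0 := fun y z h => dif_neg h
  let D := B'.compl₁₂ Z Z
  have hinj : Function.Injective D := by
    refine (injective_iff_map_eq_zero D).2 fun y hy => ?_
    have h1 : B (Z y) (Z y) = 0 := congrArg (fun f => f y) hy
    funext z
    rw [← hZ y z z.2]
    exact hdef (Z y) (hZ' y) h1 z z.2
  obtain ⟨y, hy⟩ := (LinearMap.injective_iff_surjective_of_finrank_eq_finrank
    (Subspace.dual_finrank_eq (K := ℝ) (V := {z // z ∈ innerV n} → ℝ)).symm).1 hinj (l'.comp Z)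
  refine ⟨Z y, hZ' y, fun v hv => ?_⟩
  have hvZ : ∀ z ∈ V n, v z = Z (fun z => v z) z := by
    intro z hz
    by_cases h : z ∈ V 0
    · rw [hZ' _ z fun h' => (mem_innerV.1 h').2 h, eq_zero_of_mem_V_zero hv h]
    · rw [hZ _ z (mem_innerV.2 ⟨hz, h⟩)]
  rw [hBc _ _ _ hvZ, hlc _ _ hvZ]
  exact congrArg (fun f => f fun z : {z // z ∈ innerV n} => v z) hy

theorem integrable_mul_continuous {f v : SG → ℝ} (hf : Integrable f stdMeasure)
    (hv : Continuous v) : Integrable (fun x => f x * v x) stdMeasure := by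
  obtain ⟨C, hC⟩ := isCompact_univ.exists_bound_of_continuousOn hv.continuousOn
  exact hf.mul_bdd hv.aestronglyMeasurable
    (Eventually.of_forall fun x => hC x (Set.mem_univ x))

theorem integral_mul_spline_add_smul {f : SG → ℝ} (hf : Integrable f stdMeasure) (n : ℕ)
    (v v' : SG → ℝ) (t : ℝ) :
    ∫ x, f x * spline n (fun y => v y + t * v' y) x ∂stdMeasure =
      ∫ x, f x * spline n v x ∂stdMeasure + t * ∫ x, f x * spline n v' x ∂stdMeasure := by
  simp only [spline_add_smul, mul_add]
  have h := integrable_mul_continuous hf (continuous_spline n v')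
  rw [integral_add (integrable_mul_continuous hf (continuous_spline n v))
    ((h.const_mul t).congr (Eventually.of_forall fun x => by ring)), ← integral_const_mul]
  simp only [mul_left_comm t]

theorem exists_levelSolution {f : SG → ℝ} (hf : Integrable f stdMeasure) (n : ℕ) :
    ∃ c : SG → ℝ, (∀ i, c (q i) = 0) ∧ ∀ v : SG → ℝ, (∀ i, v (q i) = 0) →
      graphEnergy n c v = -∫ x, f x * spline n v x ∂stdMeasure := by
  obtain ⟨c, hc, h⟩ := exists_forall_eq_of_definite n (graphEnergy n)
    (fun v => -∫ x, f x * spline n v x ∂stdMeasure) (graphEnergy_comm n) (graphEnergy_add_smul n)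
    (fun u hu h z hz => eq_zero_of_graphEnergy_eq_zero
      (fun i => hu _ fun h' => (mem_innerV.1 h').2 (q_mem_V_zero i)) h (mem_innerV.1 hz).1)
    (fun u v v' h => graphEnergy_congr (fun _ _ => rfl) h)
    (fun v v' t => by rw [integral_mul_spline_add_smul hf]; ring)
    (fun v v' h => by rw [spline_congr h])
  exact ⟨c, fun i => hc _ fun h' => (mem_innerV.1 h').2 (q_mem_V_zero i), h⟩

/-- The Dirichlet problem `Δ W = f`, `W = 0` on `V_0` has a solution for every integrable `f`.
Its restriction to `V_n` is the solution of the discrete problem of level `n`: these discrete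
solutions are compatible, since the energy of level `n` is that of the splines of level `n`. -/
theorem exists_isLaplacian_eq_zero {f : SG → ℝ} (hf : Integrable f stdMeasure) :
    ∃ W : SG → ℝ, IsLaplacian W f ∧ (∀ i, W (q i) = 0) ∧
      ∀ n, ∀ v : SG → ℝ, (∀ i, v (q i) = 0) →
        graphEnergy n W v = -∫ x, f x * spline n v x ∂stdMeasure := by
  classical
  choose c hc0 hc using exists_levelSolution hf
  have hcompat : ∀ n N, n ≤ N → ∀ z ∈ V n, c N z = c n z := by
    intro n N h z hz
    have hd0 : ∀ i, c N (q i) + (-1) * c n (q i) = 0 := fun i => by rw [hc0, hc0]; ring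
    have hs0 : ∀ i, spline n (fun x => c N x + (-1) * c n x) (q i) = 0 := fun i => by
      rw [spline_q]; exact hd0 i
    have hd : graphEnergy n (fun x => c N x + (-1) * c n x)
        (fun x => c N x + (-1) * c n x) = 0 := by
      rw [graphEnergy_add_smul_left, hc n _ hd0, graphEnergy_comm n (c N), ← graphEnergy_spline h,
        graphEnergy_comm, hc N _ hs0, spline_spline h]
      ring
    have := eq_zero_of_graphEnergy_eq_zero hd0 hd hz
    linarith
  let w : SG → ℝ := fun z => if h : ∃ n, z ∈ V n then c (Nat.find h) z else 0
  have hw : ∀ n, ∀ z ∈ V n, w z = c n z := by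
    intro n z hz
    have h : ∃ n, z ∈ V n := ⟨n, hz⟩
    simp only [w, dif_pos h]
    exact (hcompat _ n (Nat.find_min' h hz) z (Nat.find_spec h)).symm
  have hw0 : ∀ i, w (q i) = 0 := fun i => (hw 0 _ (q_mem_V_zero i)).trans (hc0 0 i)
  have hwE : ∀ n, ∀ v : SG → ℝ, (∀ i, v (q i) = 0) →
      graphEnergy n w v = -∫ x, f x * spline n v x ∂stdMeasure := fun n v hv => by
    rw [graphEnergy_congr (hw n) fun _ _ => rfl, hc n v hv]
  obtain ⟨I, hI⟩ : ∃ I, ∫ x, |f x| ∂stdMeasure = I := ⟨_, rfl⟩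
  have hI0 : 0 ≤ I := hI ▸ integral_nonneg fun x => abs_nonneg _
  -- testing with `w` itself bounds its energy, since splines are bounded by their energy
  have hK : ∀ n, graphEnergy n w w ≤ (4 * I) ^ 2 := by
    intro n
    have h1 : graphEnergy n w w ≤ I * (4 * √(graphEnergy n w w)) := by
      conv_lhs => rw [hwE n w hw0, ← integral_neg]
      rw [← hI, ← integral_mul_const]
      refine integral_mono (integrable_mul_continuous hf (continuous_spline n w)).neg
        (hf.abs.mul_const _) fun x => ?_
      have h2 := abs_spline_sub_le_sqrt n w x
      rw [hw0, sub_zero] at h2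
      calc -(f x * spline n w x) ≤ |f x| * |spline n w x| := by
            rw [← abs_mul]; exact neg_le_abs _
        _ ≤ _ := by gcongr
    have h3 := Real.sq_sqrt (graphEnergy_self_nonneg n w)
    have h4 := Real.sqrt_nonneg (graphEnergy n w w)
    have h5 : √(graphEnergy n w w) ≤ 4 * I := by
      by_contra! h
      nlinarith
    rw [← h3]
    gcongr
  have hb : Tendsto (fun n : ℕ => 8 * √((3 / 5) ^ n * (4 * I) ^ 2)) atTop (𝓝 0) := by
    have h : Tendsto (fun n : ℕ => (3 / 5 : ℝ) ^ n * (4 * I) ^ 2) atTop (𝓝 (0 * (4 * I) ^ 2)) :=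
      (tendsto_pow_atTop_nhds_zero_of_lt_one (by norm_num) (by norm_num)).mul_const _
    simpa using (h.sqrt).const_mul 8
  have hcauchy : ∀ x, CauchySeq fun n => spline n w x := fun x =>
    cauchySeq_of_le_tendsto_0' _ (fun n N h => by
      rw [dist_comm, Real.dist_eq]
      exact abs_spline_sub_spline_le h w hK x) hb
  choose W hW using fun x => cauchySeq_tendsto_of_complete (hcauchy x)
  have hunif : ∀ n x, |W x - spline n w x| ≤ 8 * √((3 / 5) ^ n * (4 * I) ^ 2) := fun n x =>
    le_of_tendsto ((hW x).sub_const _).abs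
      (eventually_atTop.2 ⟨n, fun N h => abs_spline_sub_spline_le h w hK x⟩)
  have hWc : Continuous W := by
    have ht : TendstoUniformly (fun n => spline n w) W atTop := by
      refine Metric.tendstoUniformly_iff.2 fun ε hε => ?_
      filter_upwards [hb.eventually (gt_mem_nhds hε)] with n hn x
      rw [Real.dist_eq]
      exact (hunif n x).trans_lt hn
    exact ht.continuous (Frequently.of_forall fun n => continuous_spline n w)
  have hWV : ∀ n, ∀ z ∈ V n, W z = w z := fun n z hz =>
    tendsto_nhds_unique (hW z) (tendsto_const_nhds.congr'
      (eventually_atTop.2 ⟨n, fun N h => (spline_eq_on_V w (V_mono h hz)).symm⟩))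
  have hWE : ∀ n, ∀ v : SG → ℝ, (∀ i, v (q i) = 0) →
      graphEnergy n W v = -∫ x, f x * spline n v x ∂stdMeasure := fun n v hv => by
    rw [graphEnergy_congr (hWV n) fun _ _ => rfl, hwE n v hv]
  refine ⟨W, ⟨⟨hWc, (4 * I) ^ 2, ?_⟩, fun v hv hv0 => ?_⟩,
    fun i => (hWV 0 _ (q_mem_V_zero i)).trans (hw0 i), hWE⟩
  · rintro _ ⟨n, rfl⟩
    exact (graphEnergy_congr (hWV n) (hWV n)).trans_le (hK n)
  · simp only [hWE _ v hv0]
    exact (tendsto_integral_mul_spline hf hv.1).neg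

/-! ### Uniqueness of the Laplacian -/

/-- Functions of finite energy that vanish on `V_0` separate integrable functions. -/
theorem ae_eq_zero_of_forall_integral_mul_eq_zero {g : SG → ℝ} (hg : Integrable g stdMeasure)
    (h : ∀ v : SG → ℝ, MemDomE v → (∀ i, v (q i) = 0) → ∫ x, g x * v x ∂stdMeasure = 0) :
    g =ᵐ[stdMeasure] 0 := by
  have hcont : ∀ v : SG → ℝ, Continuous v → (∀ i, v (q i) = 0) →
      ∫ x, g x * v x ∂stdMeasure = 0 := by
    intro v hv hv0
    refine tendsto_nhds_unique (tendsto_integral_mul_spline hg hv) ?_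
    simp only [fun n => h _ (memDomE_spline n v) fun i => (spline_q n v i).trans (hv0 i)]
    exact tendsto_const_nhds
  refine ae_eq_zero_of_forall_setIntegral_isClosed_eq_zero hg fun s hs => ?_
  -- approximate the indicator of `s` by continuous functions that vanish on the null set `V_0`
  let v : ℕ → SG → ℝ := fun n x =>
    (hs.apprSeq n x : ℝ) * min 1 (n * Metric.infDist x (Set.range q))
  have hvc : ∀ n, Continuous (v n) := fun n => by
    have h1 : Continuous fun x => ((hs.apprSeq n x : NNReal) : ℝ) :=
      NNReal.continuous_coe.comp (hs.apprSeq n).continuous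
    exact h1.mul (continuous_const.min (continuous_const.mul (Metric.continuous_infDist_pt _)))
  have hv0 : ∀ n i, v n (q i) = 0 := fun n i => by
    simp [v, Metric.infDist_zero_of_mem (Set.mem_range_self i)]
  have hlim : Tendsto (fun n => ∫ x, g x * v n x ∂stdMeasure) atTop
      (𝓝 (∫ x, g x * s.indicator (fun _ => 1) x ∂stdMeasure)) := by
    refine tendsto_integral_of_dominated_convergence (fun x => ‖g x‖)
      (fun n => hg.aestronglyMeasurable.mul (hvc n).aestronglyMeasurable) hg.norm
      (fun n => Eventually.of_forall fun x => ?_) ?_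
    · rw [norm_mul]
      refine mul_le_of_le_one_right (norm_nonneg _) ?_
      have h1 : (hs.apprSeq n x : ℝ) ≤ 1 := by
        exact_mod_cast HasOuterApproxClosed.apprSeq_apply_le_one hs n x
      have h2 : 0 ≤ min 1 (n * Metric.infDist x (Set.range q)) :=
        le_min zero_le_one (mul_nonneg (Nat.cast_nonneg n) Metric.infDist_nonneg)
      rw [Real.norm_eq_abs, abs_of_nonneg (mul_nonneg NNReal.zero_le_coe h2)]
      exact mul_le_one₀ h1 h2 (min_le_left _ _)
    · have hnull : ∀ᵐ x ∂stdMeasure, ∀ i, x ≠ q i :=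
        ae_all_iff.2 fun i => by simpa [ae_iff] using stdMeasure_q i
      filter_upwards [hnull] with x hx
      refine tendsto_const_nhds.mul ?_
      have hpos : 0 < Metric.infDist x (Set.range q) :=
        ((Set.finite_range q).isClosed.notMem_iff_infDist_pos (Set.range_nonempty q)).1
          fun ⟨i, hi⟩ => hx i hi.symm
      have h1 : Tendsto (fun n => (hs.apprSeq n x : ℝ)) atTop (𝓝 (s.indicator (fun _ => 1) x)) := by
        have h2 := (tendsto_pi_nhds.1 (HasOuterApproxClosed.tendsto_apprSeq hs)) x
        have h3 := (NNReal.continuous_coe.tendsto _).comp h2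
        have e : ((s.indicator (fun _ => (1 : NNReal)) x : NNReal) : ℝ) =
            s.indicator (fun _ => 1) x := by
          by_cases hxs : x ∈ s <;> simp [hxs]
        rwa [e] at h3
      have h2 : Tendsto (fun n : ℕ => min 1 (n * Metric.infDist x (Set.range q))) atTop (𝓝 1) := by
        refine tendsto_const_nhds.congr' ?_
        have h3 := (tendsto_natCast_atTop_atTop (R := ℝ)).atTop_mul_const hpos
        filter_upwards [h3.eventually_ge_atTop 1] with n hn
        exact (min_eq_left hn).symm
      simpa using h1.mul h2
  simp only [hcont _ (hvc _) (hv0 _)] at hlim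
  rw [← integral_indicator hs.measurableSet, tendsto_nhds_unique tendsto_const_nhds hlim]
  refine integral_congr_ae (Eventually.of_forall fun x => ?_)
  by_cases hx : x ∈ s <;> simp [hx]

theorem IsLaplacian.ae_eq {u f g : SG → ℝ} (hf : IsLaplacian u f) (hg : IsLaplacian u g)
    (hfi : Integrable f stdMeasure) (hgi : Integrable g stdMeasure) : f =ᵐ[stdMeasure] g := by
  have h := ae_eq_zero_of_forall_integral_mul_eq_zero (hfi.sub hgi) fun v hv hv0 => ?_
  · filter_upwards [h] with x hx
    exact sub_eq_zero.1 hx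
  · have h1 := tendsto_nhds_unique (hf.2 v hv hv0) (hg.2 v hv hv0)
    simp only [Pi.sub_apply, sub_mul]
    rw [integral_sub (integrable_mul_continuous hfi hv.1) (integrable_mul_continuous hgi hv.1)]
    linarith

/-! ### Cells at a vertex and summation by parts -/

theorem cellMap_zero (w : Fin 0 → Fin 3) (x : SG) : cellMap 0 w x = x := rfl

theorem cellMap_succ (n : ℕ) (w : Fin (n + 1) → Fin 3) (x : SG) :
    cellMap (n + 1) w x = F (w 0) (cellMap n (fun k => w k.succ) x) := rfl

/-- Two cells of the same level that share two points coincide. -/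
theorem eq_of_cellMap_eq_of_ne {n : ℕ} : ∀ {w w' : Fin n → Fin 3} {x x' y y' : SG},
    cellMap n w x = cellMap n w' x' → cellMap n w y = cellMap n w' y' → x ≠ y → w = w' := by
  induction n with
  | zero => intros; exact Subsingleton.elim _ _
  | succ n ih =>
    intro w w' x x' y y' hx hy hxy
    rw [cellMap_succ, cellMap_succ] at hx hy
    have h0 : w 0 = w' 0 := by
      by_contra h
      exact hxy (cellMap_injective n _
        ((eq_q_of_F_eq_F h hx).trans (eq_q_of_F_eq_F h hy).symm))
    rw [← h0] at hx hy
    have h1 := ih (F_injective _ hx) (F_injective _ hy) hxy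
    funext k
    refine Fin.cases h0 (fun k => ?_) k
    exact congrFun h1 k

open Classical in
/-- The pairs `(w, i)` with `F_w q_i = z`, that is the cells of level `n` with corner `z`. -/
def cellsAt (n : ℕ) (z : SG) : Finset ((Fin n → Fin 3) × Fin 3) :=
  {p | cellMap n p.1 (q p.2) = z}

theorem mem_cellsAt {n : ℕ} {z : SG} {p : (Fin n → Fin 3) × Fin 3} :
    p ∈ cellsAt n z ↔ cellMap n p.1 (q p.2) = z := by
  simp [cellsAt]

open Classical in
/-- The cells at `F_a x` inside `F_a SG` correspond to the cells at `x`. Another cell `F_i SG` of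
level one contains `F_a x` only if `x = q_i`, and then `F_a x = F_i q_a`. -/
theorem card_cellsAt_succ (n : ℕ) (a : Fin 3) (x : SG) :
    (cellsAt (n + 1) (F a x)).card =
      (cellsAt n x).card +
        ∑ i : Fin 3, if i ≠ a ∧ x = q i then (cellsAt n (q a)).card else 0 := by
  have hcard : ∀ (n : ℕ) (z : SG), (cellsAt n z).card =
      ∑ w : Fin n → Fin 3, ∑ j : Fin 3, if cellMap n w (q j) = z then 1 else 0 := by
    intro n z
    rw [cellsAt, Finset.card_filter, Fintype.sum_prod_type]
  rw [hcard (n + 1), ← (Fin.consEquiv fun _ => Fin 3).sum_comp, Fintype.sum_prod_type]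
  simp only [cellMap_consEquiv]
  have hi : ∀ i : Fin 3, (∑ w : Fin n → Fin 3, ∑ j : Fin 3,
      if F i (cellMap n w (q j)) = F a x then 1 else 0) =
      (if i = a then (cellsAt n x).card else 0) +
        if i ≠ a ∧ x = q i then (cellsAt n (q a)).card else 0 := by
    intro i
    by_cases h : i = a
    · subst h
      simp [(F_injective i).eq_iff, hcard]
    · by_cases hx : x = q i
      · subst hx
        simp only [F_q_comm a i, (F_injective i).eq_iff, ← hcard]
        simp [h]
      · have hne : ∀ y, F i y ≠ F a x := fun y hy => hx (eq_q_of_F_eq_F (Ne.symm h) hy.symm)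
        simp [h, hx, hne]
  rw [Finset.sum_congr rfl fun i _ => hi i, Finset.sum_add_distrib]
  simp

theorem card_cellsAt_q (n : ℕ) (j : Fin 3) : (cellsAt n (q j)).card = 1 := by
  classical
  induction n with
  | zero =>
    refine Finset.card_eq_one.2 ⟨(Fin.elim0, j), ?_⟩
    ext ⟨w, i⟩
    rw [mem_cellsAt, Finset.mem_singleton, cellMap_zero, q_injective.eq_iff, Prod.mk.injEq]
    exact ⟨fun h => ⟨Subsingleton.elim _ _, h⟩, fun h => h.2⟩
  | succ n ih =>
    have h := card_cellsAt_succ n j (q j)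
    rw [F_q, ih] at h
    rw [h, Finset.sum_eq_zero fun i _ => if_neg fun h' => h'.1 (q_injective h'.2).symm,
      add_zero]

/-- Every vertex off the boundary is a corner of exactly two cells. -/
theorem card_cellsAt {n : ℕ} : ∀ {z : SG}, z ∈ innerV n → (cellsAt n z).card = 2 := by
  classical
  induction n with
  | zero => intro z hz; exact absurd (mem_innerV.1 hz).1 (mem_innerV.1 hz).2
  | succ n ih =>
    intro z hz
    obtain ⟨hzV, hz0⟩ := mem_innerV.1 hz
    obtain ⟨⟨w, j⟩, -, rfl⟩ := Finset.mem_image.1 hzV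
    change cellMap (n + 1) w (q j) ∉ V 0 at hz0
    change (cellsAt (n + 1) (cellMap (n + 1) w (q j))).card = 2
    rw [cellMap_succ] at hz0 ⊢
    generalize hx : cellMap n (fun k => w k.succ) (q j) = x at hz0
    have hxV : x ∈ V n := hx ▸ cellMap_q_mem_V _ _
    generalize w 0 = a at hz0
    rw [card_cellsAt_succ]
    by_cases h : ∃ b, x = q b
    · obtain ⟨b, rfl⟩ := h
      have hab : b ≠ a := by
        rintro rfl
        rw [F_q] at hz0
        exact hz0 (q_mem_V_zero b)
      rw [card_cellsAt_q, card_cellsAt_q, Finset.sum_eq_single b]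
      · rw [if_pos ⟨hab, rfl⟩]
      · intro i _ hib
        rw [if_neg fun h => hib (q_injective h.2).symm]
      · exact fun h => absurd (Finset.mem_univ b) h
    · have hxi : x ∈ innerV n := mem_innerV.2 ⟨hxV, fun h0 => h (by
        obtain ⟨⟨w', b⟩, -, hb⟩ := Finset.mem_image.1 h0
        exact ⟨b, hb.symm⟩)⟩
      rw [ih hxi, Finset.sum_eq_zero fun i _ => if_neg fun h' => h ⟨i, h'.2⟩, add_zero]

/-- A sum over the neighbours of a vertex is a sum over the other corners of its cells. -/
theorem sum_neighbors (n : ℕ) (z : SG) (g : SG → ℝ) :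
    ∑ y ∈ neighbors n z, g y =
      ∑ p ∈ cellsAt n z, (g (cellMap n p.1 (q (p.2 + 1))) + g (cellMap n p.1 (q (p.2 + 2)))) := by
  classical
  have h12 : ∀ f : Fin 3 → ℝ, ∑ d ∈ ({1, 2} : Finset (Fin 3)), f d = f 1 + f 2 :=
    fun f => Finset.sum_pair (by decide)
  rw [Finset.sum_congr rfl fun (p : (Fin n → Fin 3) × Fin 3) _ =>
    (h12 fun d => g (cellMap n p.1 (q (p.2 + d)))).symm,
    ← Finset.sum_product']
  symm
  refine Finset.sum_bij (fun p _ => cellMap n p.1.1 (q (p.1.2 + p.2))) ?_ ?_ ?_ fun _ _ => rfl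
  · rintro ⟨⟨w, i⟩, d⟩ hp
    obtain ⟨h1, h2⟩ := Finset.mem_product.1 hp
    have h1 := mem_cellsAt.1 h1
    simp only at h1 h2 ⊢
    have hd : d ≠ 0 := by rintro rfl; revert h2; decide
    refine Finset.mem_filter.2 ⟨cellMap_q_mem_V _ _, ?_, w, i, i + d, h1.symm, rfl⟩
    rw [← h1]
    intro h
    have := q_injective (cellMap_injective n w h)
    exact hd (by simpa using this.symm)
  · rintro ⟨⟨w, i⟩, d⟩ hp ⟨⟨w', i'⟩, d'⟩ hp' h
    obtain ⟨h1, h2⟩ := Finset.mem_product.1 hp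
    obtain ⟨h1', -⟩ := Finset.mem_product.1 hp'
    have h1 := mem_cellsAt.1 h1
    have h1' := mem_cellsAt.1 h1'
    simp only at h1 h1' h2 h
    have hd : d ≠ 0 := by rintro rfl; revert h2; decide
    have hne : q i ≠ q (i + d) := fun h => hd (by simpa using (q_injective h).symm)
    obtain rfl := eq_of_cellMap_eq_of_ne (h1.trans h1'.symm) h hne
    obtain rfl := q_injective (cellMap_injective n w (h1.trans h1'.symm))
    have := q_injective (cellMap_injective n w h)
    rw [add_left_cancel this]
  · intro y hy
    obtain ⟨-, hne, w, i, j, h1, h2⟩ := Finset.mem_filter.1 hy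
    refine ⟨((w, i), j - i), Finset.mem_product.2 ⟨mem_cellsAt.2 h1.symm, ?_⟩, by simp [h2]⟩
    have hij : i ≠ j := by rintro rfl; exact hne (h1.trans h2.symm)
    change j - i ∈ ({1, 2} : Finset (Fin 3))
    revert hij
    clear hne h1 h2
    revert i j
    decide

/-- A sum over the corners of all cells, grouped by vertices. -/
theorem sum_cells_eq_sum_V (n : ℕ) (v : SG → ℝ) (L : (Fin n → Fin 3) → Fin 3 → ℝ) :
    ∑ w, ∑ i, v (cellMap n w (q i)) * L w i = ∑ z ∈ V n, v z * ∑ p ∈ cellsAt n z, L p.1 p.2 := by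
  classical
  rw [← Fintype.sum_prod_type (f := fun p : (Fin n → Fin 3) × Fin 3 =>
    v (cellMap n p.1 (q p.2)) * L p.1 p.2),
    ← Finset.sum_fiberwise_of_maps_to (t := V n)
      (g := fun p : (Fin n → Fin 3) × Fin 3 => cellMap n p.1 (q p.2))
      fun p _ => cellMap_q_mem_V p.1 p.2]
  refine Finset.sum_congr rfl fun z _ => ?_
  rw [Finset.mul_sum]
  refine Finset.sum_congr rfl fun p hp => ?_
  rw [(Finset.mem_filter.1 hp).2]

/-- Summation by parts on the graph of level `n`. -/
theorem graphEnergy_eq_sum_graphLaplacian (n : ℕ) (u v : SG → ℝ) :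
    graphEnergy n u v = -((5 / 3) ^ n * ∑ z ∈ V n, v z * graphLaplacian n u z) := by
  have h1 : graphEnergy n u v = (5 / 3) ^ n * ∑ w : Fin n → Fin 3, ∑ i : Fin 3,
      v (cellMap n w (q i)) * (2 * u (cellMap n w (q i)) -
        u (cellMap n w (q (i + 1))) - u (cellMap n w (q (i + 2)))) := by
    rw [graphEnergy]
    congr 1
    refine Finset.sum_congr rfl fun w _ => ?_
    simp only [Fin.sum_univ_three, show (0 : Fin 3) + 1 = 1 from rfl,
      show (1 : Fin 3) + 1 = 2 from rfl, show (2 : Fin 3) + 1 = 0 from rfl,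
      show (0 : Fin 3) + 2 = 2 from rfl, show (1 : Fin 3) + 2 = 0 from rfl,
      show (2 : Fin 3) + 2 = 1 from rfl]
    ring
  rw [h1, sum_cells_eq_sum_V n v fun w i => 2 * u (cellMap n w (q i)) -
    u (cellMap n w (q (i + 1))) - u (cellMap n w (q (i + 2))), ← mul_neg, ← Finset.sum_neg_distrib]
  congr 1
  refine Finset.sum_congr rfl fun z _ => ?_
  rw [graphLaplacian, sum_neighbors, ← mul_neg, ← Finset.sum_neg_distrib]
  congr 1
  refine Finset.sum_congr rfl fun p hp => ?_
  rw [mem_cellsAt.1 hp]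
  ring

/-! ### Integrals of products of splines -/

theorem integral_eq_sum_cellMap (n : ℕ) : ∀ {f : SG → ℝ}, Continuous f →
    ∫ x, f x ∂stdMeasure =
      (1 / 3) ^ n * ∑ w : Fin n → Fin 3, ∫ x, f (cellMap n w x) ∂stdMeasure := by
  induction n with
  | zero => intro f _; simp [cellMap_zero]
  | succ n ih =>
    intro f hf
    rw [integral_eq_sum_cells hf, ← (Fin.consEquiv fun _ => Fin 3).sum_comp,
      Fintype.sum_prod_type]
    simp only [cellMap_consEquiv]
    rw [Finset.sum_congr rfl fun i _ => ih (f := fun x => f (F i x)) (hf.comp (continuous_F i)),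
      ← Finset.mul_sum, pow_succ]
    ring

theorem integral_harm_mul_harm_eq_sum (b c : Fin 3 → ℝ) :
    ∫ x, harm b x * harm c x ∂stdMeasure =
      ∑ j, ∑ k, b j * c k * ∫ x, harmBasis j x * harmBasis k x ∂stdMeasure := by
  have hi : ∀ j k, Integrable (fun x => b j * c k * (harmBasis j x * harmBasis k x)) stdMeasure :=
    fun j k => integrable_of_continuous
      (continuous_const.mul ((continuous_harmBasis j).mul (continuous_harmBasis k)))
  simp only [← integral_const_mul]
  rw [Finset.sum_congr rfl fun j _ => (integral_finsetSum _ fun k _ => hi j k).symm,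
    ← integral_finsetSum _ fun j _ => integrable_finsetSum _ fun k _ => hi j k]
  congr 1
  funext x
  simp only [harm, Finset.sum_mul_sum]
  exact Finset.sum_congr rfl fun j _ => Finset.sum_congr rfl fun k _ => by ring

/-- Self-similarity determines the Gram matrix of the basic harmonic functions up to a factor, and
the factor is determined since they sum to one. -/
theorem integral_harmBasis_mul (j k : Fin 3) :
    ∫ x, harmBasis j x * harmBasis k x ∂stdMeasure = if j = k then 7 / 45 else 4 / 45 := by
  obtain ⟨G, hG⟩ : ∃ G : Fin 3 → Fin 3 → ℝ,
      ∀ j k, ∫ x, harmBasis j x * harmBasis k x ∂stdMeasure = G j k := ⟨_, fun _ _ => rfl⟩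
  have hsymm : ∀ j k, G j k = G k j := fun j k => by
    rw [← hG, ← hG]
    simp only [mul_comm]
  have hone : ∑ j, ∑ k, G j k = 1 := by
    have h := integral_harm_mul_harm_eq_sum (fun _ => 1) fun _ => 1
    simp only [hG, one_mul] at h
    rw [← h]
    have h1 : ∀ x, harm (fun _ => 1) x = 1 := fun x => by
      simp only [harm, Fin.sum_univ_three, one_mul, harmBasis_sum]
    simp [h1]
  have hself : ∀ b c : Fin 3 → ℝ, ∑ j, ∑ k, b j * c k * G j k =
      1 / 3 * ∑ i, ∑ j, ∑ k, harmStep i b j * harmStep i c k * G j k := by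
    intro b c
    have h := integral_eq_sum_cells (f := fun x => harm b x * harm c x)
      ((continuous_harm b).mul (continuous_harm c))
    simp only [harm_F, integral_harm_mul_harm_eq_sum, hG] at h
    exact h
  -- the self-similarity relation on pairs of basis vectors is a linear system for the entries
  have e00 := hself (Pi.single 0 1) (Pi.single 0 1)
  have e11 := hself (Pi.single 1 1) (Pi.single 1 1)
  have e22 := hself (Pi.single 2 1) (Pi.single 2 1)
  have e01 := hself (Pi.single 0 1) (Pi.single 1 1)
  have e02 := hself (Pi.single 0 1) (Pi.single 2 1)
  clear hself
  simp [Fin.sum_univ_three, harmStep, Pi.single_apply, hsymm 1 0, hsymm 2 0, hsymm 2 1]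
    at e00 e11 e22 e01 e02 hone
  have h00 : G 0 0 = 7 / 45 := by
    linear_combination 1235 / 756 * e00 + 5 / 252 * e11 + 5 / 252 * e22 + 80 / 189 * e01 +
      80 / 189 * e02 + 7 / 45 * hone
  have h11 : G 1 1 = 7 / 45 := by
    linear_combination -145 / 756 * e00 + 1075 / 756 * e11 - 145 / 756 * e22 -
      80 / 189 * e02 + 7 / 45 * hone
  have h22 : G 2 2 = 7 / 45 := by
    linear_combination -145 / 756 * e00 - 145 / 756 * e11 + 1075 / 756 * e22 -
      80 / 189 * e01 + 7 / 45 * hone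
  have h01 : G 0 1 = 4 / 45 := by
    linear_combination 25 / 1512 * e00 + 25 / 1512 * e11 - 55 / 1512 * e22 + 235 / 189 * e01 +
      4 / 45 * hone
  have h02 : G 0 2 = 4 / 45 := by
    linear_combination 25 / 1512 * e00 - 55 / 1512 * e11 + 25 / 1512 * e22 + 235 / 189 * e02 +
      4 / 45 * hone
  have h12 : G 1 2 = 4 / 45 := by linarith
  rw [hG]
  fin_cases j <;> fin_cases k <;>
    simp [h00, h11, h22, h01, h02, h12, hsymm 1 0, hsymm 2 0, hsymm 2 1]

theorem integral_harm_mul_harm (b c : Fin 3 → ℝ) :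
    ∫ x, harm b x * harm c x ∂stdMeasure =
      ∑ i, c i * ((7 * b i + 4 * (b (i + 1) + b (i + 2))) / 45) := by
  rw [integral_harm_mul_harm_eq_sum]
  simp only [integral_harmBasis_mul, Fin.sum_univ_three, show (0 : Fin 3) + 1 = 1 from rfl,
      show (1 : Fin 3) + 1 = 2 from rfl, show (2 : Fin 3) + 1 = 0 from rfl,
      show (0 : Fin 3) + 2 = 2 from rfl, show (1 : Fin 3) + 2 = 0 from rfl,
      show (2 : Fin 3) + 2 = 1 from rfl]
  simp
  ring

open Classical in
/-- Integration against the tent function at an inner vertex. -/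
theorem integral_spline_mul_tent {n : ℕ} {z : SG} (hz : z ∈ innerV n) (u : SG → ℝ) :
    ∫ x, spline n u x * spline n (fun y => if y = z then 1 else 0) x ∂stdMeasure =
      (1 / 3) ^ n * ((14 * u z + 4 * ∑ y ∈ neighbors n z, u y) / 45) := by
  have hc : Continuous fun x => spline n u x * spline n (fun y => if y = z then 1 else 0) x :=
    (continuous_spline n _).mul (continuous_spline n _)
  rw [integral_eq_sum_cellMap n hc]
  simp only [spline_cellMap, integral_harm_mul_harm]
  rw [sum_cells_eq_sum_V n (fun y => if y = z then 1 else 0) fun w i =>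
    (7 * u (cellMap n w (q i)) +
      4 * (u (cellMap n w (q (i + 1))) + u (cellMap n w (q (i + 2))))) / 45]
  simp only [ite_mul, one_mul, zero_mul]
  rw [Finset.sum_ite_eq' (V n) z, if_pos (mem_innerV.1 hz).1, sum_neighbors]
  congr 1
  have hconst : ∑ p ∈ cellsAt n z, 7 * u z = 14 * u z := by
    rw [Finset.sum_const, card_cellsAt hz, nsmul_eq_mul]
    push_cast
    ring
  rw [← hconst, Finset.mul_sum, ← Finset.sum_add_distrib, Finset.sum_div]
  refine Finset.sum_congr rfl fun p hp => ?_
  rw [mem_cellsAt.1 hp]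

/-! ### The minimizer -/

theorem memLp_of_continuous {f : SG → ℝ} (hf : Continuous f) : MemLp f 2 stdMeasure := by
  obtain ⟨C, hC⟩ := isCompact_univ.exists_bound_of_continuousOn hf.continuousOn
  exact MemLp.of_bound hf.aestronglyMeasurable C
    (Eventually.of_forall fun x => hC x (Set.mem_univ x))

theorem MemDomL2Laplacian.laplacian_spec {u : SG → ℝ} (hu : MemDomL2Laplacian u) :
    MemLp (laplacian u) 2 stdMeasure ∧ IsLaplacian u (laplacian u) := by
  unfold laplacian
  split_ifs with h
  · exact ⟨memLp_of_continuous h.choose_spec.1, h.choose_spec.2⟩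
  · exact hu.choose_spec

theorem T_eq {u f : SG → ℝ} (hf : MemLp f 2 stdMeasure) (h : IsLaplacian u f) :
    T u = ∫ x, f x ^ 2 ∂stdMeasure := by
  obtain ⟨h1, h2⟩ := MemDomL2Laplacian.laplacian_spec ⟨f, hf, h⟩
  refine integral_congr_ae ?_
  filter_upwards [h2.ae_eq h (h1.integrable one_le_two) (hf.integrable one_le_two)] with x hx
  rw [hx]

theorem MemDomE.add_smul {u w : SG → ℝ} (hu : MemDomE u) (hw : MemDomE w) (t : ℝ) :
    MemDomE fun x => u x + t * w x := by
  obtain ⟨hu1, A, hA⟩ := hu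
  obtain ⟨hw1, B, hB⟩ := hw
  refine ⟨hu1.add (continuous_const.mul hw1), 2 * A + 2 * t ^ 2 * B, ?_⟩
  rintro _ ⟨n, rfl⟩
  have h1 := hA ⟨n, rfl⟩
  have h2 := hB ⟨n, rfl⟩
  have h3 := graphEnergy_self_nonneg n fun x => u x + (-t) * w x
  simp only [graphEnergy_add_smul, graphEnergy_add_smul_left] at h1 h2 h3 ⊢
  nlinarith [sq_nonneg t, mul_le_mul_of_nonneg_left h2 (sq_nonneg t)]

theorem IsLaplacian.add_smul {u w f g : SG → ℝ} (hu : IsLaplacian u f) (hw : IsLaplacian w g)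
    (hf : Integrable f stdMeasure) (hg : Integrable g stdMeasure) (t : ℝ) :
    IsLaplacian (fun x => u x + t * w x) fun x => f x + t * g x := by
  refine ⟨hu.1.add_smul hw.1 t, fun v hv hv0 => ?_⟩
  simp only [graphEnergy_add_smul_left]
  have e : -∫ x, (f x + t * g x) * v x ∂stdMeasure =
      -∫ x, f x * v x ∂stdMeasure + t * -∫ x, g x * v x ∂stdMeasure := by
    simp only [add_mul, mul_assoc]
    rw [integral_add (integrable_mul_continuous hf hv.1)
      ((integrable_mul_continuous hg hv.1).const_mul t), integral_const_mul]
    ring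
  rw [e]
  exact (hu.2 v hv hv0).add ((hw.2 v hv hv0).const_mul t)

/-- The first variation of `T` vanishes at a minimizer. -/
theorem IsMinimizer.integral_mul_eq_zero {E : Set SG} {a u w f g : SG → ℝ}
    (hu : IsMinimizer E a u) (hf : MemLp f 2 stdMeasure) (huf : IsLaplacian u f)
    (hg : MemLp g 2 stdMeasure) (hwg : IsLaplacian w g) (hw : ∀ x ∈ E, w x = 0) :
    ∫ x, f x * g x ∂stdMeasure = 0 := by
  have hfg : Integrable (fun x => f x * g x) stdMeasure := hf.integrable_mul hg
  have key : ∀ t : ℝ, 0 ≤ (∫ x, g x ^ 2 ∂stdMeasure) * (t * t) +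
      (2 * ∫ x, f x * g x ∂stdMeasure) * t + 0 := by
    intro t
    have hL := huf.add_smul hwg (hf.integrable one_le_two) (hg.integrable one_le_two) t
    have hM : MemLp (fun x => f x + t * g x) 2 stdMeasure := hf.add (hg.const_mul t)
    have h := hu.2.2 _ ⟨_, hM, hL⟩ fun x hx => by rw [hw x hx, mul_zero, add_zero, hu.2.1 x hx]
    rw [T_eq hf huf, T_eq hM hL] at h
    have hi1 : Integrable (fun x => 2 * t * (f x * g x)) stdMeasure := hfg.const_mul _
    have hi2 : Integrable (fun x => t ^ 2 * g x ^ 2) stdMeasure := hg.integrable_sq.const_mul _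
    have hi3 : Integrable (fun x => 2 * t * (f x * g x) + t ^ 2 * g x ^ 2) stdMeasure :=
      hi1.add hi2
    have e : ∫ x, (f x + t * g x) ^ 2 ∂stdMeasure = ∫ x, f x ^ 2 ∂stdMeasure +
        (2 * t * ∫ x, f x * g x ∂stdMeasure + t ^ 2 * ∫ x, g x ^ 2 ∂stdMeasure) := by
      rw [← integral_const_mul, ← integral_const_mul,
        ← integral_add hi1 hi2, ← integral_add hf.integrable_sq hi3]
      congr 1
      funext x
      ring
    rw [e] at h
    linarith
  have := discrim_le_zero key
  rw [discrim] at this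
  nlinarith [sq_nonneg (∫ x, f x * g x ∂stdMeasure)]

/-- The orthogonal projection in `L²` to the splines of level `n` that vanish on `V_0`. -/
theorem exists_spline_projection {f : SG → ℝ} (hf : Integrable f stdMeasure) (n : ℕ) :
    ∃ c : SG → ℝ, (∀ i, c (q i) = 0) ∧ ∀ v : SG → ℝ, (∀ i, v (q i) = 0) →
      ∫ x, spline n c x * spline n v x ∂stdMeasure = ∫ x, f x * spline n v x ∂stdMeasure := by
  have hdef : ∀ u : SG → ℝ, (∀ z, z ∉ innerV n → u z = 0) →
      ∫ x, spline n u x * spline n u x ∂stdMeasure = 0 → ∀ z ∈ innerV n, u z = 0 := by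
    intro u _ hB z hz
    have hcont : Continuous fun x => spline n u x * spline n u x :=
      (continuous_spline n u).mul (continuous_spline n u)
    have h1 := (integral_eq_zero_iff_of_nonneg (fun x => mul_self_nonneg (spline n u x))
      (integrable_of_continuous hcont)).1 hB
    have h2 := mul_self_eq_zero.1 (eq_zero_of_ae_eq_zero hcont h1 z)
    rwa [spline_eq_on_V u (mem_innerV.1 hz).1] at h2
  obtain ⟨c, hc, h⟩ := exists_forall_eq_of_definite n
    (fun u v => ∫ x, spline n u x * spline n v x ∂stdMeasure)
    (fun v => ∫ x, f x * spline n v x ∂stdMeasure)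
    (fun u v => by simp only [mul_comm])
    (fun u => integral_mul_spline_add_smul (integrable_of_continuous (continuous_spline n u)) n)
    hdef
    (fun u v v' h => by rw [spline_congr h])
    (integral_mul_spline_add_smul hf n)
    (fun v v' h => by rw [spline_congr h])
  exact ⟨c, fun i => hc _ fun h' => (mem_innerV.1 h').2 (q_mem_V_zero i), h⟩

/-- The Laplacian of a minimizer is a spline. Its deviation from its projection is the Laplacian of
a function that vanishes on `V_m`, so it is orthogonal both to itself and to the projection. -/
theorem IsMinimizer.exists_isLaplacian_spline {m : ℕ} {E : Set SG} (hE : E ⊆ (V m : Set SG))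
    {a u : SG → ℝ} (hu : IsMinimizer E a u) :
    ∃ c : SG → ℝ, (∀ i, c (q i) = 0) ∧ IsLaplacian u (spline m c) := by
  obtain ⟨f, hf, huf⟩ := hu.1
  have hfi := hf.integrable one_le_two
  obtain ⟨c, hc0, hc⟩ := exists_spline_projection hfi m
  have hg := memLp_of_continuous (continuous_spline m c)
  have hgi := hg.integrable one_le_two
  have hd : MemLp (fun x => f x - spline m c x) 2 stdMeasure := hf.sub hg
  have hdi : Integrable (fun x => f x - spline m c x) stdMeasure := hfi.sub hgi
  have horth : ∀ v : SG → ℝ, (∀ i, v (q i) = 0) →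
      ∫ x, (f x - spline m c x) * spline m v x ∂stdMeasure = 0 := by
    intro v hv
    simp only [sub_mul]
    rw [integral_sub (integrable_mul_continuous hfi (continuous_spline m v))
      (integrable_mul_continuous hgi (continuous_spline m v)), hc v hv, sub_self]
  obtain ⟨W, hW, hW0, hWE⟩ := exists_isLaplacian_eq_zero hdi
  have hWV : ∀ z ∈ V m, W z = 0 := fun z hz => eq_zero_of_graphEnergy_eq_zero hW0
    (by rw [hWE m W hW0, horth W hW0, neg_zero]) hz
  have h1 := hu.integral_mul_eq_zero hf huf hd hW fun x hx => hWV x (hE hx)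
  have h2 : ∫ x, (f x - spline m c x) ^ 2 ∂stdMeasure = 0 := by
    have e : ∫ x, (f x - spline m c x) ^ 2 ∂stdMeasure =
        ∫ x, f x * (f x - spline m c x) ∂stdMeasure -
          ∫ x, (f x - spline m c x) * spline m c x ∂stdMeasure := by
      have hi : Integrable (fun x => f x * (f x - spline m c x)) stdMeasure :=
        hf.integrable_mul hd
      rw [← integral_sub hi
        (integrable_mul_continuous hdi (continuous_spline m c))]
      congr 1
      funext x
      ring
    rw [e, h1, horth c hc0, sub_zero]
  have h3 := (integral_eq_zero_iff_of_nonneg (fun x => sq_nonneg (f x - spline m c x))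
    hd.integrable_sq).1 h2
  refine ⟨c, hc0, huf.1, fun v hv hv0 => ?_⟩
  have e : ∫ x, spline m c x * v x ∂stdMeasure = ∫ x, f x * v x ∂stdMeasure := by
    refine integral_congr_ae ?_
    filter_upwards [h3] with x hx
    have : f x - spline m c x = 0 := by simpa using hx
    rw [sub_eq_zero.1 this]
  rw [e]
  exact huf.2 v hv hv0

end Gasket

end

open Gasket in
theorem mainTheorem11 (m : ℕ) (E : Set Gasket.SG) (hE : E ⊆ (Gasket.V m : Set Gasket.SG))
    (a u : Gasket.SG → ℝ) (hu : Gasket.IsMinimizer E a u) :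
    Gasket.MemDomLaplacian u ∧
    (∀ x ∈ Gasket.V 0, Gasket.laplacian u x = 0) ∧
    (∀ z ∈ Gasket.innerV m,
      Gasket.graphLaplacian m u z =
        (14 * Gasket.laplacian u z + 4 * ∑ y ∈ Gasket.neighbors m z, Gasket.laplacian u y) /
          (45 * 5 ^ m)) ∧
    Gasket.T u =
      ((3 / 5 : ℝ) ^ m)⁻¹ *
        ∑ z ∈ Gasket.innerV m, Gasket.laplacian u z * Gasket.graphLaplacian m u z := by
  classical
  obtain ⟨c, hc0, hL⟩ := hu.exists_isLaplacian_spline hE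
  have hdom : MemDomLaplacian u := ⟨_, continuous_spline m c, hL⟩
  have hcont : Continuous (laplacian u) := by
    rw [laplacian, dif_pos hdom]
    exact hdom.choose_spec.1
  -- two continuous Laplacians agree almost everywhere, hence everywhere
  have hlap : laplacian u = spline m c := by
    funext x
    have h1 := hu.1.laplacian_spec.2.ae_eq hL (integrable_of_continuous hcont)
      (integrable_of_continuous (continuous_spline m c))
    refine sub_eq_zero.1 (eq_zero_of_ae_eq_zero (hcont.sub (continuous_spline m c)) ?_ x)
    filter_upwards [h1] with y hy
    exact sub_eq_zero.2 hy
  have hlapV : ∀ z ∈ V m, laplacian u z = c z := fun z hz => by rw [hlap, spline_eq_on_V c hz]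
  -- the energy of level `m` against a spline of level `m` is the full energy
  have hweak : ∀ v : SG → ℝ, (∀ i, v (q i) = 0) →
      (5 / 3) ^ m * ∑ z ∈ V m, v z * graphLaplacian m u z =
        ∫ x, spline m c x * spline m v x ∂stdMeasure := by
    intro v hv
    have h1 := hL.2 _ (memDomE_spline m v) fun i => (spline_q m v i).trans (hv i)
    have h2 : Tendsto (fun n => graphEnergy n u (spline m v)) atTop (𝓝 (graphEnergy m u v)) :=
      tendsto_const_nhds.congr' (eventually_atTop.2 ⟨m, fun n hn => by
        simp only
        rw [graphEnergy_comm n, graphEnergy_spline hn, graphEnergy_comm]⟩)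
    have h3 := tendsto_nhds_unique h1 h2
    rw [graphEnergy_eq_sum_graphLaplacian] at h3
    linarith
  refine ⟨hdom, fun x hx => ?_, fun z hz => ?_, ?_⟩
  · rw [hlapV x (V_mono (Nat.zero_le m) hx), eq_zero_of_mem_V_zero hc0 hx]
  · obtain ⟨hzV, hz0⟩ := mem_innerV.1 hz
    have h1 := hweak (fun y => if y = z then 1 else 0) fun i =>
      if_neg fun h => hz0 (by rw [← h]; exact q_mem_V_zero i)
    rw [integral_spline_mul_tent hz] at h1
    simp only [ite_mul, one_mul, zero_mul] at h1
    rw [Finset.sum_ite_eq' (V m) z, if_pos hzV] at h1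
    rw [hlapV z hzV, Finset.sum_congr (s₁ := neighbors m z) rfl
      fun y hy => hlapV y (Finset.mem_filter.1 hy).1]
    rw [div_pow, div_pow, one_pow] at h1
    have h3 : (3 : ℝ) ^ m ≠ 0 := by positivity
    have h5 : (5 : ℝ) ^ m ≠ 0 := by positivity
    field_simp at h1 ⊢
    linarith
  · rw [T_eq (memLp_of_continuous (continuous_spline m c)) hL]
    simp only [pow_two (spline m c _)]
    rw [← hweak c hc0, ← inv_pow, inv_div]
    congr 1
    refine ((Finset.sum_subset (s₁ := innerV m) Finset.sdiff_subset fun z hz hz' => ?_).symm.trans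
      (Finset.sum_congr rfl fun z hz => ?_))
    · have hz0 : z ∈ V 0 := by
        by_contra h
        exact hz' (mem_innerV.2 ⟨hz, h⟩)
      rw [eq_zero_of_mem_V_zero hc0 hz0, zero_mul]
    · rw [hlapV z (mem_innerV.1 hz).1]
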